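/- **Setting.** Let $S$ be an associative unital ring and $T=\bigoplus_{n\ge 0}T^n$ a connected, strongly graded $S$-ring: $T^0=S$ and $T^mT^n=T^{m+n}$ for all $m,n$. Unadorned tensor products are over $S$. Put $T^{\le m}=\bigoplus_{n\le m}T^n$. For $0\ne a=\sum_{i=0}^d a_i\in T$ with $a_i\in T^i$, $a_d\neq 0$, let $\mathrm{LH}(a)=a_d$ and $a^*=\sum_{i=0}^d a_iz^{d-i}\in T[z]$ ($z$ a central variable of degree $1$); $\mathrm{LH}(0)=0$. Let $P\subseteq T$ be an $S$-subbimodule, $P^{\le n}=P\cap T^{\le n}$, $R_P=\bigoplus_n R_P^n$ with $R_P^n=\mathrm{LH}(P)\cap T^n$, and $P^*=\{p^*: p\in P\}$. Let $A=T/\langle R_P\rangle$, $U=T/\langle P\rangle$ filtered by the images $U^{\le n}$ of $T^{\le n}$, and $D=T[z]/\langle P^*\rangle$, with $\pi:D\to A$ induced by $z\mapsto 0$. * $P$ is *of PBW-type* if $\Phi_P:A\to \operatorname{gr}U$, $x+\langle R_P\rangle\mapsto (x+\langle P\rangle)+U^{\le n-1}$ for $x\in T^n$, is an isomorphism of graded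 $S$-rings. * $P$ satisfies $(\mathcal J_n)$ if $P_{n+1}\cap T^{\le n}\subseteq P_n$, where $P_n=\sum_{i+j+k=n}T^{\le i}P^{\le j}T^{\le k}$. * The complexity of a graded $S$-module $V$ is $c_V=-1$ if $V=0$ and $c_V=\sup\{n-1: V^n\ne 0\}\in\mathbb Z\cup\{\infty\}$ otherwise. Assume that $P\cap S=0$ and that $A^1$ is a projective left $S$-module. Fix a resolution of the left $A$-module $S$ by graded $A$-linear maps $$\cdots\to A\otimes V_3\xrightarrow{d_3}A\otimes V_2\xrightarrow{d_2}A\otimes A^1\xrightarrow{d_1}A\xrightarrow{d_0} S\to 0,$$ where $V_0=S$, $V_1=A^1$, each $V_n=\bigoplus_{i\ge0}V_n^i$ is a graded projective left $S$-module, $d_0$ is the projection, $d_1$ is induced by the multiplication of $A$, and $V_n^i=0$ for $n\ge 3$ and $i\le 1$. Put $N_n=D\otimes V_n$. Let $\partial_n:N_n\to N_{n-1}$ ($n\ge1$) be graded $D$-linear maps with $(\pi\otimes V_{n-1})\partial_n=d_n(\pi\otimes V_n)$, and let $f_n:N_n\to N_{n-2}(-1)$ ($n\ge2$) be graded $D$-linear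 maps with $\partial_{n-1}\partial_n=(-1)^{n-1}z\,f_n$. Let $M_0=N_0$ and $M_n=N_n\oplus N_{n-1}(-1)$ for $n\geq 1$, with $\delta_1(x,y)=\partial_1(x)+zy$ and $\delta_n(x,y)=\big(\partial_n(x)+(-1)^{n-1}zy,\ \partial_{n-1}(y)+f_n(x)\big)$ for $n\ge2$. Let ${}^1M_*$ be the complex $M_2\xrightarrow{\delta_2}M_1\xrightarrow{\delta_1}M_0\to0$, so that $H_1({}^1M_*)=\ker\delta_1/\operatorname{im}\delta_2$. **Theorem.** Such maps $\partial_n$, $f_n$ exist, and for every choice of them: $P$ is of PBW-type if and only if $H_1({}^1M_*)=0$ and either $c_{V_3}=-1$ or $P$ satisfies $(\mathcal J_n)$ for all integers $n$ with $1\le n\le c_{V_3}$ (for all $n\ge1$ if $c_{V_3}=\infty$). -/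

import Mathlib

open scoped TensorProduct DirectSum
open Polynomial

noncomputable section

/-! ## Connected graded `S`-rings and subbimodules -/

/-- A positively graded connected `S`-ring structure on the ring `T`: a grading
`T = ⨁ₙ deg n` of the ring `T` and a ring homomorphism `ι : S → T` (not assumed central) which
identifies `S` with `deg 0`. -/
structure ConnGradedRing (S : Type*) (T : Type*) [Ring S] [Ring T] where
  deg : ℕ → AddSubgroup T
  [graded : GradedRing deg]
  ι : S →+* T
  ι_injective : Function.Injective ι
  ι_range : ∀ t : T, t ∈ deg 0 ↔ ∃ s : S, ι s = t

attribute [instance] ConnGradedRing.graded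

namespace ConnGradedRing

variable {S : Type*} {T : Type*} [Ring S] [Ring T] (𝒯 : ConnGradedRing S T)

/-- `Tᵐ Tⁿ = Tᵐ⁺ⁿ`, where `Tᵐ Tⁿ` is the additive subgroup generated by the products. -/
def StronglyGraded : Prop :=
  ∀ m n : ℕ, 𝒯.deg (m + n) =
    AddSubgroup.closure {x | ∃ a ∈ 𝒯.deg m, ∃ b ∈ 𝒯.deg n, x = a * b}

/-- The standard filtration `T^{≤ m} = ⨁_{n ≤ m} Tⁿ`. -/
def filt (m : ℕ) : AddSubgroup T := ⨆ n, ⨆ _ : n ≤ m, 𝒯.deg n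

/-- `⨁_{n < m} Tⁿ`: this is `T^{≤ m - 1}` for `m > 0`, and `0` for `m = 0`. -/
def filtLT (m : ℕ) : AddSubgroup T := ⨆ n, ⨆ _ : n < m, 𝒯.deg n

/-- The projection of `t` onto the homogeneous component of degree `n`, viewed in `T`. -/
def comp (t : T) (n : ℕ) : T := (DirectSum.decompose 𝒯.deg t n : T)

open Classical in
/-- The largest `n` with `tₙ ≠ 0` (and `0` when `t = 0`). -/
def topDegree (t : T) : ℕ := (DirectSum.decompose 𝒯.deg t).support.sup id

/-- The homogeneous part of highest degree `LH(t)`; `LH(0) = 0`. -/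
def leadHom (t : T) : T := 𝒯.comp t (𝒯.topDegree t)

/-- The external homogenization `t* = ∑_{i ≤ d} tᵢ z^{d - i}`, `d` the top degree of `t`. -/
def homogenize (t : T) : T[X] :=
  ∑ i ∈ Finset.range (𝒯.topDegree t + 1), C (𝒯.comp t i) * X ^ (𝒯.topDegree t - i)

/-- The homogeneous component of degree `n` of `T[z]`, namely `∑ᵢ Tⁱ z^{n - i}`. -/
def polyDeg (n : ℕ) : AddSubgroup T[X] :=
  AddSubgroup.closure {p | ∃ i j : ℕ, i + j = n ∧ ∃ t ∈ 𝒯.deg i, p = C t * X ^ j}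

end ConnGradedRing

/-- An `S`-subbimodule of the `S`-ring `T`. -/
structure SSubbimodule {S : Type*} {T : Type*} [Ring S] [Ring T] (𝒯 : ConnGradedRing S T)
    extends AddSubgroup T where
  left_mem : ∀ (s : S) {x : T}, x ∈ carrier → 𝒯.ι s * x ∈ carrier
  right_mem : ∀ (s : S) {x : T}, x ∈ carrier → x * 𝒯.ι s ∈ carrier

namespace SSubbimodule

variable {S : Type*} {T : Type*} [Ring S] [Ring T] {𝒯 : ConnGradedRing S T}

/-- `P^{≤ n} = P ∩ T^{≤ n}`. -/
def filt (P : SSubbimodule 𝒯) (n : ℕ) : AddSubgroup T := P.toAddSubgroup ⊓ 𝒯.filt n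

/-- `R_P = ⋃ₙ R_Pⁿ`, the homogeneous elements of `R_P`: here `R_Pⁿ = LH(P) ∩ Tⁿ`. -/
def leadSet (P : SSubbimodule 𝒯) : Set T :=
  {x | ∃ n, x ∈ 𝒯.deg n ∧ ∃ p ∈ P.toAddSubgroup, 𝒯.leadHom p = x}

/-- `P* = {p* | p ∈ P}`. -/
def starSet (P : SSubbimodule 𝒯) : Set T[X] :=
  {f | ∃ p ∈ P.toAddSubgroup, 𝒯.homogenize p = f}

/-- `P_n = ∑_{i + j + k = n} T^{≤ i} · P^{≤ j} · T^{≤ k}`. -/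
def jacFilt (P : SSubbimodule 𝒯) (n : ℕ) : AddSubgroup T :=
  AddSubgroup.closure {x | ∃ i j k : ℕ, i + j + k = n ∧
    ∃ a ∈ 𝒯.filt i, ∃ p ∈ P.filt j, ∃ b ∈ 𝒯.filt k, x = a * p * b}

/-- The Jacobi condition `(J_n)`: `P_{n+1} ∩ T^{≤ n} ⊆ P_n`. -/
def Jacobi (P : SSubbimodule 𝒯) (n : ℕ) : Prop :=
  P.jacFilt (n + 1) ⊓ 𝒯.filt n ≤ P.jacFilt n

/-! ### The three rings `U(P)`, `A(R_P)` and `D(P)` -/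

/-- The two-sided ideal `⟨P⟩`. -/
def idealP (P : SSubbimodule 𝒯) : TwoSidedIdeal T :=
  TwoSidedIdeal.span (P.toAddSubgroup : Set T)

/-- The two-sided ideal `⟨R_P⟩`. -/
def idealR (P : SSubbimodule 𝒯) : TwoSidedIdeal T := TwoSidedIdeal.span P.leadSet

/-- The two-sided ideal `⟨P*⟩` of `T[z]`. -/
def idealStar (P : SSubbimodule 𝒯) : TwoSidedIdeal T[X] := TwoSidedIdeal.span P.starSet

/-- The non-homogeneous algebra `U(P) = T / ⟨P⟩`. -/
def U (P : SSubbimodule 𝒯) : Type _ := T ⧸ P.idealP.asIdeal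

instance (P : SSubbimodule 𝒯) : Ring P.U := inferInstanceAs (Ring (T ⧸ P.idealP.asIdeal))

/-- The homogeneous algebra `A = A(R_P) = T / ⟨R_P⟩`. -/
def A (P : SSubbimodule 𝒯) : Type _ := T ⧸ P.idealR.asIdeal

instance (P : SSubbimodule 𝒯) : Ring P.A := inferInstanceAs (Ring (T ⧸ P.idealR.asIdeal))

/-- The central extension `D = D(P) = T[z] / ⟨P*⟩`. -/
def D (P : SSubbimodule 𝒯) : Type _ := T[X] ⧸ P.idealStar.asIdeal

instance (P : SSubbimodule 𝒯) : Ring P.D := inferInstanceAs (Ring (T[X] ⧸ P.idealStar.asIdeal))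

/-- The canonical projection `T → U`. -/
def mkU (P : SSubbimodule 𝒯) : T →+* P.U := Ideal.Quotient.mk P.idealP.asIdeal

/-- The canonical projection `T → A`. -/
def mkA (P : SSubbimodule 𝒯) : T →+* P.A := Ideal.Quotient.mk P.idealR.asIdeal

/-- The canonical projection `T[z] → D`. -/
def mkD (P : SSubbimodule 𝒯) : T[X] →+* P.D := Ideal.Quotient.mk P.idealStar.asIdeal

/-- The structure map `S → A`. -/
def unitA (P : SSubbimodule 𝒯) : S →+* P.A := P.mkA.comp 𝒯.ι

/-- The structure map `S → D`. -/
def unitD (P : SSubbimodule 𝒯) : S →+* P.D := P.mkD.comp ((C : T →+* T[X]).comp 𝒯.ι)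

/-- The left `S`-module structure of `A`. -/
instance (P : SSubbimodule 𝒯) : Module S P.A := Module.compHom P.A P.unitA

theorem mem_idealP_iff (P : SSubbimodule 𝒯) (t : T) : P.mkU t = 0 ↔ t ∈ P.idealP := by
  rw [← TwoSidedIdeal.mem_asIdeal]
  exact Ideal.Quotient.eq_zero_iff_mem

theorem mem_idealR_iff (P : SSubbimodule 𝒯) (t : T) : P.mkA t = 0 ↔ t ∈ P.idealR := by
  rw [← TwoSidedIdeal.mem_asIdeal]
  exact Ideal.Quotient.eq_zero_iff_mem

theorem mem_idealStar_iff (P : SSubbimodule 𝒯) (t : T[X]) : P.mkD t = 0 ↔ t ∈ P.idealStar := by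
  rw [← TwoSidedIdeal.mem_asIdeal]
  exact Ideal.Quotient.eq_zero_iff_mem

/-- The homogeneous component `Aⁿ`, the image of `Tⁿ`, as a left `S`-module. -/
def degA (P : SSubbimodule 𝒯) (n : ℕ) : Submodule S P.A where
  __ := (𝒯.deg n).map (P.mkA : T →+ P.A)
  smul_mem' := by
    rintro s _ ⟨t, ht, rfl⟩
    refine ⟨𝒯.ι s * t, ?_, ?_⟩
    · have h := SetLike.mul_mem_graded ((𝒯.ι_range _).2 ⟨s, rfl⟩) ht
      rwa [zero_add] at h
    · change P.mkA (𝒯.ι s * t) = P.mkA (𝒯.ι s) * P.mkA t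
      exact map_mul _ _ _

/-- The homogeneous component `Dⁿ`, the image of `T[z]ⁿ`. -/
def degD (P : SSubbimodule 𝒯) (n : ℕ) : AddSubgroup P.D :=
  (𝒯.polyDeg n).map (P.mkD : T[X] →+ P.D)

/-! ### The associated graded ring of `U(P)` and the map `Φ_P` -/

/-- `U^{≤ n}`, the image of `T^{≤ n}`. -/
def filtU (P : SSubbimodule 𝒯) (n : ℕ) : AddSubgroup P.U := (𝒯.filt n).map (P.mkU : T →+ P.U)

/-- `U^{≤ n - 1}`, with the convention `U^{≤ -1} = 0`. -/
def filtLTU (P : SSubbimodule 𝒯) (n : ℕ) : AddSubgroup P.U :=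
  (𝒯.filtLT n).map (P.mkU : T →+ P.U)

/-- `grⁿ U = U^{≤ n} / U^{≤ n - 1}`. -/
abbrev grU (P : SSubbimodule 𝒯) (n : ℕ) : Type _ :=
  P.filtU n ⧸ (P.filtLTU n).addSubgroupOf (P.filtU n)

theorem mkU_mem_filtU (P : SSubbimodule 𝒯) {n : ℕ} {x : T} (hx : x ∈ 𝒯.deg n) :
    P.mkU x ∈ P.filtU n :=
  ⟨x, (le_iSup₂_of_le (f := fun k (_ : k ≤ n) => 𝒯.deg k) n le_rfl le_rfl) hx, rfl⟩

/-- `φ_Pⁿ : Tⁿ → grⁿ U`, `x ↦ (x + ⟨P⟩) + U^{≤ n - 1}`. -/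
def phi (P : SSubbimodule 𝒯) (n : ℕ) : 𝒯.deg n →+ P.grU n :=
  (QuotientAddGroup.mk' _).comp
    { toFun := fun x => ⟨P.mkU x, P.mkU_mem_filtU x.2⟩
      map_zero' := by ext; simp
      map_add' := fun x y => by ext; simp }

/-- The projection `Tⁿ → Aⁿ`. -/
def projA (P : SSubbimodule 𝒯) (n : ℕ) : 𝒯.deg n →+ P.degA n where
  toFun x := ⟨P.mkA x, x, x.2, rfl⟩
  map_zero' := by ext; simp
  map_add' x y := by ext; simp

theorem projA_surjective (P : SSubbimodule 𝒯) (n : ℕ) : Function.Surjective (P.projA n) := by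
  rintro ⟨_, t, ht, rfl⟩
  exact ⟨⟨t, ht⟩, rfl⟩

/-- Auxiliary: `⟨P⟩ + T^{≤ n - 1}`. -/
def lowP (P : SSubbimodule 𝒯) (n : ℕ) : AddSubgroup T :=
  (P.filtLTU n).comap (P.mkU : T →+ P.U)

theorem mem_lowP (P : SSubbimodule 𝒯) {n : ℕ} {x : T} :
    x ∈ P.lowP n ↔ ∃ y ∈ 𝒯.filtLT n, P.mkU y = P.mkU x := Iff.rfl

theorem mul_mem_filtLT {i j : ℕ} {a y : T} (ha : a ∈ 𝒯.deg i) (hy : y ∈ 𝒯.filtLT j) :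
    a * y ∈ 𝒯.filtLT (i + j) ∧ y * a ∈ 𝒯.filtLT (j + i) := by
  have key : 𝒯.filtLT j ≤ (𝒯.filtLT (i + j)).comap (AddMonoidHom.mulLeft a) ⊓
      (𝒯.filtLT (j + i)).comap (AddMonoidHom.mulRight a) := by
    refine iSup₂_le fun k hk x hx => ⟨?_, ?_⟩
    · exact (le_iSup₂_of_le (f := fun l (_ : l < i + j) => 𝒯.deg l) (i + k) (by omega) le_rfl)
        (SetLike.mul_mem_graded ha hx)
    · exact (le_iSup₂_of_le (f := fun l (_ : l < j + i) => 𝒯.deg l) (k + i) (by omega) le_rfl)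
        (SetLike.mul_mem_graded hx ha)
  exact key hy

theorem mul_mem_lowP (P : SSubbimodule 𝒯) {i j : ℕ} {a x : T} (ha : a ∈ 𝒯.deg i)
    (hx : x ∈ P.lowP j) : a * x ∈ P.lowP (i + j) ∧ x * a ∈ P.lowP (j + i) := by
  obtain ⟨y, hy, h⟩ := P.mem_lowP.1 hx
  exact ⟨P.mem_lowP.2 ⟨a * y, (mul_mem_filtLT ha hy).1, by simp [h]⟩,
    P.mem_lowP.2 ⟨y * a, (mul_mem_filtLT ha hy).2, by simp [h]⟩⟩

/-- Auxiliary: the two-sided ideal of the elements whose component of degree `n` lies in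
`⟨P⟩ + T^{≤ n - 1}` for every `n`. -/
def lowIdeal (P : SSubbimodule 𝒯) : TwoSidedIdeal T :=
  TwoSidedIdeal.mk' {x | ∀ n, 𝒯.comp x n ∈ P.lowP n}
    (fun n => by simp [ConnGradedRing.comp])
    (fun {x y} hx hy n => by
      have := add_mem (hx n) (hy n)
      simpa [ConnGradedRing.comp] using this)
    (fun {x} hx n => by
      have := neg_mem (hx n)
      have h : 𝒯.comp (-x) n = -𝒯.comp x n := by
        have h' : 𝒯.comp (-x) n + 𝒯.comp x n = 0 := by
          simp only [ConnGradedRing.comp]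
          rw [← AddSubgroup.coe_add, ← DirectSum.add_apply, ← DirectSum.decompose_add]
          simp
        exact eq_neg_of_add_eq_zero_left h'
      rwa [h])
    (fun {x y} hy n => by
      induction x using DirectSum.Decomposition.inductionOn 𝒯.deg with
      | zero => simp [ConnGradedRing.comp]
      | @homogeneous i a =>
        simp only [ConnGradedRing.comp]
        by_cases h : i ≤ n
        · rw [DirectSum.coe_decompose_mul_of_left_mem_of_le 𝒯.deg a.2 h]
          have := (P.mul_mem_lowP a.2 (hy (n - i))).1
          rwa [Nat.add_sub_cancel' h] at this
        · rw [DirectSum.coe_decompose_mul_of_left_mem_of_not_le 𝒯.deg a.2 h]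
          exact zero_mem _
      | add a b ha hb =>
        have := add_mem ha hb
        simpa [ConnGradedRing.comp, add_mul] using this)
    (fun {x y} hx n => by
      induction y using DirectSum.Decomposition.inductionOn 𝒯.deg with
      | zero => simp [ConnGradedRing.comp]
      | @homogeneous i a =>
        simp only [ConnGradedRing.comp]
        by_cases h : i ≤ n
        · rw [DirectSum.coe_decompose_mul_of_right_mem_of_le 𝒯.deg a.2 h]
          have := (P.mul_mem_lowP a.2 (hx (n - i))).2
          rwa [Nat.sub_add_cancel h] at this
        · rw [DirectSum.coe_decompose_mul_of_right_mem_of_not_le 𝒯.deg a.2 h]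
          exact zero_mem _
      | add a b ha hb =>
        have := add_mem ha hb
        simpa [ConnGradedRing.comp, mul_add] using this)

theorem comp_eq_zero_of_topDegree_lt {p : T} {i : ℕ} (h : 𝒯.topDegree p < i) :
    𝒯.comp p i = 0 := by
  classical
  by_contra hne
  have : i ∈ (DirectSum.decompose 𝒯.deg p).support := by
    rw [DFinsupp.mem_support_toFun]
    intro h0
    exact hne (by simp [ConnGradedRing.comp, h0])
  have := Finset.le_sup (f := id) this
  unfold ConnGradedRing.topDegree at h
  simp only [id] at this
  have h2 : i ≤ (DirectSum.decompose 𝒯.deg p).support.sup id := this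
  apply absurd h
  rw [not_lt]
  convert h2

theorem sub_leadHom_mem (p : T) : p - 𝒯.leadHom p ∈ 𝒯.filtLT (𝒯.topDegree p) := by
  classical
  have hsum := DirectSum.sum_support_decompose 𝒯.deg p
  set d := 𝒯.topDegree p with hd
  have hle : ∀ i ∈ (DirectSum.decompose 𝒯.deg p).support, i ∈ Finset.range (d + 1) := by
    intro i hi
    by_contra hcon
    rw [Finset.mem_range, not_lt] at hcon
    have h0 : 𝒯.comp p i = 0 := comp_eq_zero_of_topDegree_lt (by omega)
    rw [DFinsupp.mem_support_toFun] at hi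
    exact hi (Subtype.ext h0)
  have hsum2 : ∑ i ∈ Finset.range (d + 1), 𝒯.comp p i = p := by
    rw [← hsum]
    symm
    rw [hsum]
    conv_lhs => rw [← hsum]
    refine Finset.sum_subset hle ?_
    intro i _ hi
    rw [DFinsupp.mem_support_toFun, not_not] at hi
    simp [hi]
  have : p - 𝒯.leadHom p = ∑ i ∈ Finset.range d, 𝒯.comp p i := by
    rw [Finset.sum_range_succ] at hsum2
    exact sub_eq_of_eq_add hsum2.symm
  rw [this]
  refine sum_mem fun i hi => ?_
  exact (le_iSup₂_of_le (f := fun l (_ : l < d) => 𝒯.deg l) i (Finset.mem_range.1 hi) le_rfl)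
    (SetLike.coe_mem _)

theorem idealR_le_lowIdeal (P : SSubbimodule 𝒯) : P.idealR ≤ P.lowIdeal := by
  refine TwoSidedIdeal.span_le.2 ?_
  rintro _ ⟨n, -, p, hp, rfl⟩
  change 𝒯.leadHom p ∈ P.lowIdeal
  rw [lowIdeal, TwoSidedIdeal.mem_mk']
  intro m
  have hmem : 𝒯.leadHom p ∈ 𝒯.deg (𝒯.topDegree p) := SetLike.coe_mem _
  by_cases h : 𝒯.topDegree p = m
  · subst h
    have h1 : 𝒯.comp (𝒯.leadHom p) (𝒯.topDegree p) = 𝒯.leadHom p :=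
      DirectSum.decompose_of_mem_same 𝒯.deg hmem
    rw [h1]
    refine P.mem_lowP.2 ⟨𝒯.leadHom p - p, ?_, ?_⟩
    · have := neg_mem (sub_leadHom_mem (𝒯 := 𝒯) p)
      rwa [neg_sub] at this
    · have : P.mkU p = 0 := (P.mem_idealP_iff p).2 (TwoSidedIdeal.subset_span hp)
      rw [map_sub, this, sub_zero]
  · have h1 : 𝒯.comp (𝒯.leadHom p) m = 0 :=
      DirectSum.decompose_of_mem_ne 𝒯.deg hmem h
    rw [h1]
    exact zero_mem _

theorem ker_projA_le (P : SSubbimodule 𝒯) (n : ℕ) : (P.projA n).ker ≤ (P.phi n).ker := by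
  intro x hx
  have h0 : P.mkA (x : T) = 0 := congrArg Subtype.val (AddMonoidHom.mem_ker.1 hx)
  have h1 := P.idealR_le_lowIdeal ((P.mem_idealR_iff _).1 h0)
  rw [lowIdeal, TwoSidedIdeal.mem_mk'] at h1
  have h2 := h1 n
  have h3 : 𝒯.comp (x : T) n = x := DirectSum.decompose_of_mem_same 𝒯.deg x.2
  rw [h3] at h2
  rw [AddMonoidHom.mem_ker]
  refine (QuotientAddGroup.eq_zero_iff _).2 ?_
  exact AddSubgroup.mem_addSubgroupOf.2 h2

/-- `Φ_Pⁿ : Aⁿ → grⁿ U`, `x + ⟨R_P⟩ ↦ (x + ⟨P⟩) + U^{≤ n - 1}` for `x ∈ Tⁿ`. -/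
def PhiDeg (P : SSubbimodule 𝒯) (n : ℕ) : P.degA n →+ P.grU n :=
  (P.projA n).liftOfSurjective (P.projA_surjective n) ⟨P.phi n, P.ker_projA_le n⟩

theorem PhiDeg_projA (P : SSubbimodule 𝒯) (n : ℕ) (x : 𝒯.deg n) :
    P.PhiDeg n (P.projA n x) = P.phi n x :=
  AddMonoidHom.liftOfRightInverse_comp_apply _ _ _ ⟨P.phi n, P.ker_projA_le n⟩ x

/-- `Φ_P = ⨁ₙ Φ_Pⁿ : A → gr U`, where `A = ⨁ₙ Aⁿ` and `gr U = ⨁ₙ grⁿ U`. -/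
def Phi (P : SSubbimodule 𝒯) : (⨁ n, P.degA n) →+ ⨁ n, P.grU n := DirectSum.map P.PhiDeg

/-- `P` is of PBW-type if and only if `Φ_P` is an isomorphism. (`Φ_P` is a morphism of graded
`S`-rings, so it is an isomorphism of such exactly when it is bijective.) -/
def PBWType (P : SSubbimodule 𝒯) : Prop := Function.Bijective P.Phi

/-! ### The projection `π : D → A` and the central element `z` -/

theorem leadHom_mem_leadSet (P : SSubbimodule 𝒯) {p : T} (hp : p ∈ P.toAddSubgroup) :
    𝒯.leadHom p ∈ P.leadSet :=
  ⟨𝒯.topDegree p, SetLike.coe_mem _, p, hp, rfl⟩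

theorem constantCoeff_homogenize (p : T) :
    constantCoeff (𝒯.homogenize p) = 𝒯.leadHom p := by
  rw [ConnGradedRing.homogenize, Finset.sum_range_succ, map_add, map_sum,
    Finset.sum_eq_zero]
  · simp [ConnGradedRing.leadHom]
  · intro i hi
    have : 𝒯.topDegree p - i ≠ 0 := by
      have := Finset.mem_range.1 hi
      omega
    simp [coeff_X_pow, this.symm]

theorem idealStar_le_comap (P : SSubbimodule 𝒯) :
    P.idealStar ≤ P.idealR.comap (constantCoeff : T[X] →+* T) := by
  refine TwoSidedIdeal.span_le.2 ?_
  rintro _ ⟨p, hp, rfl⟩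
  change 𝒯.homogenize p ∈ P.idealR.comap (constantCoeff : T[X] →+* T)
  rw [TwoSidedIdeal.mem_comap, constantCoeff_homogenize]
  exact TwoSidedIdeal.subset_span (P.leadHom_mem_leadSet hp)

/-- The projection `π : D → A` induced by the evaluation `z ↦ 0`. -/
def piDA (P : SSubbimodule 𝒯) : P.D →+* P.A :=
  Ideal.Quotient.lift P.idealStar.asIdeal (P.mkA.comp (constantCoeff : T[X] →+* T)) (by
    intro f hf
    have h := P.idealStar_le_comap (TwoSidedIdeal.mem_asIdeal.1 hf)
    rw [TwoSidedIdeal.mem_comap] at h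
    exact (P.mem_idealR_iff _).2 h)

theorem piDA_mkD (P : SSubbimodule 𝒯) (f : T[X]) :
    P.piDA (P.mkD f) = P.mkA (constantCoeff f) := rfl

theorem piDA_unitD (P : SSubbimodule 𝒯) (s : S) : P.piDA (P.unitD s) = P.unitA s := by
  simp [unitD, unitA, piDA_mkD]

/-- The class of `z` in `D`. -/
def z (P : SSubbimodule 𝒯) : P.D := P.mkD X

theorem z_mul (P : SSubbimodule 𝒯) (x : P.D) : P.z * x = x * P.z := by
  obtain ⟨f, rfl⟩ : ∃ f, P.mkD f = x := Ideal.Quotient.mk_surjective x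
  rw [z, ← map_mul, ← map_mul, X_mul]

/-- Multiplication by the central element `z` on a left `D`-module. -/
def zAct (P : SSubbimodule 𝒯) (N : Type*) [AddCommGroup N] [Module P.D N] : N →ₗ[P.D] N where
  toFun x := P.z • x
  map_add' := smul_add _
  map_smul' a x := by
    simp only [RingHom.id_apply, smul_smul, P.z_mul]

end SSubbimodule

/-! ## The tensor product `B ⊗_S V` over a noncommutative ring -/

section BaseExt

variable {S : Type*} {B : Type*} {C : Type*} [Ring S] [Ring B] [Ring C]
  (φ : S →+* B) (ψ : S →+* C) (V : Type*) [AddCommGroup V] [Module S V]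

/-- The relations `b s ⊗ v = b ⊗ s v`. -/
def baseExtRel : Submodule B (B ⊗[ℤ] V) :=
  Submodule.span B {t | ∃ (b : B) (s : S) (v : V), t = (b * φ s) ⊗ₜ[ℤ] v - b ⊗ₜ[ℤ] (s • v)}

/-- The left `B`-module `B ⊗_S V`, where `B` is a right `S`-module through `φ : S → B`. -/
def BaseExt : Type _ := (B ⊗[ℤ] V) ⧸ baseExtRel φ V

instance : AddCommGroup (BaseExt φ V) :=
  inferInstanceAs (AddCommGroup ((B ⊗[ℤ] V) ⧸ baseExtRel φ V))

instance : Module B (BaseExt φ V) :=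
  inferInstanceAs (Module B ((B ⊗[ℤ] V) ⧸ baseExtRel φ V))

namespace BaseExt

/-- The projection `B ⊗_ℤ V → B ⊗_S V`. -/
def mk : B ⊗[ℤ] V →ₗ[B] BaseExt φ V := (baseExtRel φ V).mkQ

variable {V}

/-- The element `b ⊗ v` of `B ⊗_S V`. -/
def tmul (b : B) (v : V) : BaseExt φ V := mk φ V (b ⊗ₜ[ℤ] v)

/-- The homogeneous component `(B ⊗_S V)ⁿ = ∑_{i + j = n} Bⁱ ⊗ Vʲ`. -/
def deg (𝓑 : ℕ → AddSubgroup B) (𝒱 : ℕ → Submodule S V) (n : ℕ) : AddSubgroup (BaseExt φ V) :=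
  AddSubgroup.closure {x | ∃ i j : ℕ, i + j = n ∧ ∃ b ∈ 𝓑 i, ∃ v ∈ 𝒱 j, x = tmul φ b v}

variable (V)

/-- Auxiliary: the map `π ⊗ V : B ⊗_ℤ V → C ⊗_ℤ V` induced by a ring map `π : B → C`. -/
def mapAux (π : B →+* C) : B ⊗[ℤ] V →ₛₗ[π] C ⊗[ℤ] V where
  toFun x := TensorProduct.map (π : B →+ C).toIntLinearMap (LinearMap.id : V →ₗ[ℤ] V) x
  map_add' x y := map_add _ x y
  map_smul' b x := by
    induction x using TensorProduct.induction_on with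
    | zero => simp
    | tmul c v => simp [TensorProduct.smul_tmul']
    | add x y hx hy => simp only [smul_add, map_add, hx, hy]

/-- The map `π ⊗ V : B ⊗_S V → C ⊗_S V` induced by a morphism `π : B → C` of `S`-rings. -/
def map (π : B →+* C) (h : ∀ s, π (φ s) = ψ s) : BaseExt φ V →ₛₗ[π] BaseExt ψ V :=
  (baseExtRel φ V).liftQ ((mk ψ V).comp (mapAux V π)) (by
    refine Submodule.span_le.2 ?_
    rintro _ ⟨b, s, v, rfl⟩
    refine (Submodule.Quotient.mk_eq_zero _).2 (Submodule.subset_span ⟨π b, s, v, ?_⟩)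
    simp [mapAux, h])

theorem map_tmul (π : B →+* C) (h : ∀ s, π (φ s) = ψ s) (b : B) (v : V) :
    map φ ψ V π h (tmul φ b v) = tmul ψ (π b) v := rfl

end BaseExt

end BaseExt

/-! ## Resolutions, complexity, and the complex `¹M` -/

open Classical in
/-- The complexity of a graded module `V = ⨁ₙ Vⁿ`: it is `-1` if `V = 0`, and otherwise
`sup {n - 1 | Vⁿ ≠ 0}`, which may be infinite. -/
def complexity {S V : Type*} [Ring S] [AddCommGroup V] [Module S V]
    (𝒱 : ℕ → Submodule S V) : EReal :=
  if ∀ n, 𝒱 n = ⊥ then -1 else sSup {c : EReal | ∃ n : ℕ, 𝒱 n ≠ ⊥ ∧ c = (n : EReal) - 1}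

variable {S : Type*} {T : Type*} [Ring S] [Ring T] {𝒯 : ConnGradedRing S T}

/-- A projective resolution of the left `A`-module `S` of the form
`⋯ → A ⊗ V₃ → A ⊗ V₂ → A ⊗ A¹ → A → S → 0`,
where every `Vₙ` is a graded projective left `S`-module, the differentials are graded and
`A`-linear, `V₀ = S` and `V₁ = A¹` (via `e0` and `e1`), `d₁` is induced by the multiplication of
`A`, and `Vₙⁱ = 0` for `n ≥ 3` and `i ≤ 1`. Here `d n : A ⊗ Vₙ₊₁ → A ⊗ Vₙ` is the
differential with index `n + 1`. -/
structure SpecialResolution (P : SSubbimodule 𝒯) where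
  V : ℕ → Type*
  [acg : ∀ n, AddCommGroup (V n)]
  [mod : ∀ n, Module S (V n)]
  gr : ∀ n, ℕ → Submodule S (V n)
  internal : ∀ n, DirectSum.IsInternal (gr n)
  projective : ∀ n, Module.Projective S (V n)
  e0 : S ≃ₗ[S] V 0
  gr_zero : gr 0 0 = ⊤
  e1 : P.degA 1 ≃ₗ[S] V 1
  gr_one : gr 1 1 = ⊤
  d : ∀ n, BaseExt P.unitA (V (n + 1)) →ₗ[P.A] BaseExt P.unitA (V n)
  d_graded : ∀ n k, ∀ x ∈ BaseExt.deg P.unitA (fun i => (P.degA i).toAddSubgroup) (gr (n + 1)) k,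
    d n x ∈ BaseExt.deg P.unitA (fun i => (P.degA i).toAddSubgroup) (gr n) k
  d_one : ∀ (b : P.A) (a : P.degA 1),
    d 0 (BaseExt.tmul P.unitA b (e1 a)) = BaseExt.tmul P.unitA (b * (a : P.A)) (e0 1)
  /-- Exactness at `A ⊗ V₀ = A`: the kernel of the projection `A → S` is `A⁺`. -/
  exact_zero : LinearMap.range (d 0) = Submodule.span P.A
    {x | ∃ k, 0 < k ∧ ∃ a ∈ P.degA k, ∃ v : V 0, x = BaseExt.tmul P.unitA a v}
  exact : ∀ n, Function.Exact (d (n + 1)) (d n)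
  vanishing : ∀ n, 3 ≤ n → ∀ i, i ≤ 1 → gr n i = ⊥

attribute [instance] SpecialResolution.acg SpecialResolution.mod

namespace SpecialResolution

variable {P : SSubbimodule 𝒯} (R : SpecialResolution P)

/-- `Nₙ = D ⊗ Vₙ`. -/
abbrev N (n : ℕ) : Type _ := BaseExt P.unitD (R.V n)

/-- The homogeneous components of `Nₙ`. -/
def degN (n k : ℕ) : AddSubgroup (R.N n) := BaseExt.deg P.unitD P.degD (R.gr n) k

/-- `π ⊗ Vₙ : D ⊗ Vₙ → A ⊗ Vₙ`. -/
def piV (n : ℕ) : R.N n →ₛₗ[P.piDA] BaseExt P.unitA (R.V n) :=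
  BaseExt.map P.unitD P.unitA (R.V n) P.piDA P.piDA_unitD

/-- The choices made in the construction of the sequence `(M, δ)`: graded `D`-linear maps
`∂ₙ₊₁ = del n : Nₙ₊₁ → Nₙ` lifting `dₙ₊₁`, and graded `D`-linear maps
`fₙ₊₂ = f n : Nₙ₊₂ → Nₙ(-1)` with `∂ₙ₊₁ ∂ₙ₊₂ = (-1)ⁿ⁺¹ z fₙ₊₂`. -/
structure Lift where
  del : ∀ n, R.N (n + 1) →ₗ[P.D] R.N n
  del_graded : ∀ n k, ∀ x ∈ R.degN (n + 1) k, del n x ∈ R.degN n k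
  piV_del : ∀ n x, R.piV n (del n x) = R.d n (R.piV (n + 1) x)
  f : ∀ n, R.N (n + 2) →ₗ[P.D] R.N n
  f_graded : ∀ n k, ∀ x ∈ R.degN (n + 2) (k + 1), f n x ∈ R.degN n k
  f_graded_zero : ∀ n, ∀ x ∈ R.degN (n + 2) 0, f n x = 0
  del_del : ∀ n x, del n (del (n + 1) x) = (-1 : ℤ) ^ (n + 1) • (P.z • f n x)

namespace Lift

variable {R} (L : R.Lift)

/-- `δ₁ : M₁ = N₁ ⊕ N₀(-1) → M₀ = N₀`, `(x, y) ↦ ∂₁ x + z y`. -/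
def delta1 : (R.N 1 × R.N 0) →ₗ[P.D] R.N 0 :=
  (L.del 0).coprod (P.zAct (R.N 0))

/-- `δₙ₊₂ : Mₙ₊₂ = Nₙ₊₂ ⊕ Nₙ₊₁(-1) → Mₙ₊₁ = Nₙ₊₁ ⊕ Nₙ(-1)`,
`(x, y) ↦ (∂ₙ₊₂ x + (-1)ⁿ⁺¹ z y, ∂ₙ₊₁ y + fₙ₊₂ x)`. -/
def delta (n : ℕ) : (R.N (n + 2) × R.N (n + 1)) →ₗ[P.D] (R.N (n + 1) × R.N n) :=
  ((L.del (n + 1)).coprod ((-1 : ℤ) ^ (n + 1) • P.zAct (R.N (n + 1)))).prod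
    ((L.f n).coprod (L.del n))

theorem delta1_delta (x : R.N 2 × R.N 1) : L.delta1 (L.delta 0 x) = 0 := by
  obtain ⟨x, y⟩ := x
  have h : L.del 0 (L.del 1 x) = (-1 : ℤ) ^ 1 • (P.z • L.f 0 x) := L.del_del 0 x
  change L.del 0 (L.del 1 x + (-1 : ℤ) ^ 1 • (P.z • y)) + P.z • (L.f 0 x + L.del 0 y) = 0
  rw [map_add, h, map_zsmul, map_smul, smul_add, pow_one, neg_smul, one_smul, neg_smul, one_smul]
  abel

/-- The first homology of the complex `¹M : M₂ → M₁ → M₀ → 0`, that is `ker δ₁ / im δ₂`. -/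
abbrev H1 : Type _ :=
  LinearMap.ker L.delta1 ⧸
    LinearMap.range ((L.delta 0).codRestrict (LinearMap.ker L.delta1) L.delta1_delta)

end Lift

end SpecialResolution

end

/-!
The theorem is reduced to a single property, the regularity of the central element `z` on `D`.

The Rees homomorphism `rees : T[z] → T[X]` (`t ↦ t Xⁱ` for `t ∈ Tⁱ`, `z ↦ X`) identifies `T[z]` with
`⨁ₙ T^{≤ n} Xⁿ` and the ideal `⟨P*⟩` with `⨁ₙ Pₙ Xⁿ` (`mem_idealStar_iff_coeff`). Hence
`Dⁿ = T^{≤ n} / Pₙ`, with `z` induced by the inclusions `T^{≤ n} ⊆ T^{≤ n + 1}`, and the condition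
`(Jₙ)` says that `z : Dⁿ → Dⁿ⁺¹` is injective. As `ker π = z D`, one has
`Aⁿ = T^{≤ n} / (Pₙ + T^{≤ n - 1})`, and since `⟨P⟩ = ⋃ₙ Pₙ`, a descending induction shows that `P`
is of PBW-type if and only if all conditions `(Jₙ)` hold, that is, if and only if `z` is regular on
`D` (`pbwType_iff_z_regular`).

Each `Vₙ` is graded projective, so graded maps out of `Nₙ = D ⊗ Vₙ` can be lifted along graded
surjections, and the kernel of `Nₙ → A ⊗ Vₙ` is `z Nₙ`. This gives the maps `∂ₙ`, and it gives `fₙ`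
because `∂ ∂` vanishes modulo `z` (`nonempty_lift`).

If `z` is regular, a diagram chase lifts the exactness of the resolution at `A ⊗ V₁` to `H₁ = 0`
(`subsingleton_H1_of_z_regular`). Conversely, `g = ∂₁ f₃ + f₂ ∂₃ : N₃ → N₀ = D` satisfies
`z g = 0` and maps the generators `V₃ⁱ` to `Dⁱ⁻¹`, where `z` is injective by `(Jᵢ₋₁)` whenever `V₃ⁱ ≠ 0`;
thus `g = 0`, which makes `M₃ → M₂ → M₁` a complex (`del_f_add_f_del_eq_zero`). Given `y ∈ D` with
`z y = 0`, the cycle `(0, y)` of `M₁` is a boundary, and after subtracting a boundary from `M₃` it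
is the image of some `(0, u)` with `z u = 0`. So `y = ∂₁ u` with `u ∈ K ⊗ V₁`, where `K` is the
annihilator of `z` in `D`, and `∂₁` maps `V₁` to `D¹`. This shows `K = K D¹`
(`mem_closure_of_z_mul`), and since `D` is positively graded, `K = 0` (`z_regular`).
-/

noncomputable section

/-! ### The Rees ring of `T` -/

namespace ConnGradedRing

variable {S : Type*} {T : Type*} [Ring S] [Ring T] (𝒯 : ConnGradedRing S T)

theorem comp_add (s t : T) (n : ℕ) : 𝒯.comp (s + t) n = 𝒯.comp s n + 𝒯.comp t n := by
  simp [comp]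

theorem comp_mem (t : T) (n : ℕ) : 𝒯.comp t n ∈ 𝒯.deg n := SetLike.coe_mem _

theorem comp_of_mem {t : T} {i : ℕ} (ht : t ∈ 𝒯.deg i) (n : ℕ) :
    𝒯.comp t n = if i = n then t else 0 := by
  split_ifs with h
  · subst h
    exact DirectSum.decompose_of_mem_same 𝒯.deg ht
  · exact DirectSum.decompose_of_mem_ne 𝒯.deg ht h

theorem homogeneous_induction {p : T → Prop} (h : ∀ i, ∀ t ∈ 𝒯.deg i, p t)
    (hadd : ∀ s t, p s → p t → p (s + t)) (t : T) : p t := by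
  induction t using DirectSum.Decomposition.inductionOn 𝒯.deg with
  | zero => exact h 0 0 (zero_mem _)
  | homogeneous a => exact h _ _ a.2
  | add a b ha hb => exact hadd a b ha hb

theorem deg_le_filt {i n : ℕ} (h : i ≤ n) : 𝒯.deg i ≤ 𝒯.filt n :=
  le_iSup₂_of_le (f := fun k (_ : k ≤ n) => 𝒯.deg k) i h le_rfl

theorem deg_le_filtLT {i n : ℕ} (h : i < n) : 𝒯.deg i ≤ 𝒯.filtLT n :=
  le_iSup₂_of_le (f := fun k (_ : k < n) => 𝒯.deg k) i h le_rfl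

theorem filtLT_succ (n : ℕ) : 𝒯.filtLT (n + 1) = 𝒯.filt n := by
  simp only [filtLT, filt, Nat.lt_succ_iff]

theorem filtLT_zero : 𝒯.filtLT 0 = ⊥ := by
  simp [filtLT]

theorem filt_mono {m n : ℕ} (h : m ≤ n) : 𝒯.filt m ≤ 𝒯.filt n :=
  iSup₂_le fun _ hi => 𝒯.deg_le_filt (hi.trans h)

theorem filtLT_le_filt (n : ℕ) : 𝒯.filtLT n ≤ 𝒯.filt n :=
  iSup₂_le fun _ hi => 𝒯.deg_le_filt hi.le

theorem one_mem_deg : (1 : T) ∈ 𝒯.deg 0 := SetLike.one_mem_graded _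

theorem ι_mem_deg (s : S) : 𝒯.ι s ∈ 𝒯.deg 0 := (𝒯.ι_range _).2 ⟨s, rfl⟩

theorem one_mem_filt (n : ℕ) : (1 : T) ∈ 𝒯.filt n :=
  𝒯.deg_le_filt (Nat.zero_le n) 𝒯.one_mem_deg

/-- The coaction `t ↦ ∑ᵢ tᵢ Xⁱ` encoding the grading of `T`. -/
def coaction : T →+* T[X] :=
  (DirectSum.toSemiring
    (fun i => (monomial i : T →ₗ[T] T[X]).toAddMonoidHom.comp (𝒯.deg i).subtype)
    (by simp) (fun {i j} a b => by simp [monomial_mul_monomial])).comp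
    (DirectSum.decomposeRingEquiv 𝒯.deg : T →+* ⨁ i, 𝒯.deg i)

theorem coaction_of_mem {t : T} {i : ℕ} (ht : t ∈ 𝒯.deg i) : 𝒯.coaction t = monomial i t := by
  lift t to 𝒯.deg i using ht
  change DirectSum.toAddMonoid
    (fun i => (monomial i : T →ₗ[T] T[X]).toAddMonoidHom.comp (𝒯.deg i).subtype)
    (DirectSum.decompose 𝒯.deg (t : T)) = _
  rw [DirectSum.decompose_coe, DirectSum.toAddMonoid_of]
  rfl

@[simp]
theorem coeff_coaction (t : T) (n : ℕ) : (𝒯.coaction t).coeff n = 𝒯.comp t n := by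
  induction t using 𝒯.homogeneous_induction with
  | h i t ht => rw [𝒯.coaction_of_mem ht, coeff_monomial, 𝒯.comp_of_mem ht]
  | hadd s t hs ht => rw [map_add, coeff_add, hs, ht, comp_add]

theorem comp_eq_zero_of_mem_filt {t : T} {n i : ℕ} (ht : t ∈ 𝒯.filt n) (h : n < i) :
    𝒯.comp t i = 0 := by
  have : 𝒯.filt n ≤ (GradedRing.proj 𝒯.deg i).ker := iSup₂_le fun k hk x hx =>
    DirectSum.decompose_of_mem_ne 𝒯.deg hx (by omega)
  exact this ht

theorem comp_of_mem_filtLT {t : T} {n : ℕ} (ht : t ∈ 𝒯.filtLT n) : 𝒯.comp t n = 0 := by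
  have : 𝒯.filtLT n ≤ (GradedRing.proj 𝒯.deg n).ker := iSup₂_le fun k hk x hx =>
    DirectSum.decompose_of_mem_ne 𝒯.deg hx (by omega)
  exact this ht

theorem natDegree_coaction_le {t : T} {n : ℕ} (ht : t ∈ 𝒯.filt n) :
    (𝒯.coaction t).natDegree ≤ n :=
  natDegree_le_iff_coeff_eq_zero.2 fun i hi => by
    rw [coeff_coaction, 𝒯.comp_eq_zero_of_mem_filt ht hi]

theorem sum_comp {t : T} {n : ℕ} (h : ∀ i, n < i → 𝒯.comp t i = 0) :
    ∑ i ∈ Finset.range (n + 1), 𝒯.comp t i = t := by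
  classical
  conv_rhs => rw [← DirectSum.sum_support_decompose 𝒯.deg t]
  refine (Finset.sum_subset (fun i hi => ?_) (fun i _ hi => ?_)).symm
  · by_contra hc
    rw [Finset.mem_range, not_lt] at hc
    exact (DFinsupp.mem_support_toFun _ _).1 hi (Subtype.ext (h i (by omega)))
  · rw [DFinsupp.mem_support_toFun, not_not] at hi
    simp [comp, hi]

theorem sub_comp_mem_filtLT {t : T} {n : ℕ} (ht : t ∈ 𝒯.filt n) :
    t - 𝒯.comp t n ∈ 𝒯.filtLT n := by
  have h := 𝒯.sum_comp (fun i => 𝒯.comp_eq_zero_of_mem_filt ht)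
  rw [Finset.sum_range_succ] at h
  rw [← eq_sub_of_add_eq h]
  exact sum_mem fun i hi => 𝒯.deg_le_filtLT (Finset.mem_range.1 hi) (𝒯.comp_mem t i)

theorem mul_mem_filt {a b : T} {i j : ℕ} (ha : a ∈ 𝒯.filt i) (hb : b ∈ 𝒯.filt j) :
    a * b ∈ 𝒯.filt (i + j) := by
  have h1 : ∀ k ≤ i, ∀ x ∈ 𝒯.deg k, 𝒯.filt j ≤ (𝒯.filt (i + j)).comap (AddMonoidHom.mulLeft x) :=
    fun k hk x hx => iSup₂_le fun l hl y hy =>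
      𝒯.deg_le_filt (by omega : k + l ≤ i + j) (SetLike.mul_mem_graded hx hy)
  have h2 : 𝒯.filt i ≤ (𝒯.filt (i + j)).comap (AddMonoidHom.mulRight b) :=
    iSup₂_le fun k hk x hx => h1 k hk x hx hb
  exact h2 ha

theorem mem_filt_topDegree (t : T) : t ∈ 𝒯.filt (𝒯.topDegree t) := by
  have h : ∑ i ∈ Finset.range (𝒯.topDegree t + 1), 𝒯.comp t i ∈ 𝒯.filt (𝒯.topDegree t) :=
    sum_mem fun i hi =>
      𝒯.deg_le_filt (Nat.lt_succ_iff.1 (Finset.mem_range.1 hi)) (𝒯.comp_mem t i)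
  rwa [𝒯.sum_comp (fun i => SSubbimodule.comp_eq_zero_of_topDegree_lt)] at h

theorem topDegree_le {t : T} {n : ℕ} (ht : t ∈ 𝒯.filt n) : 𝒯.topDegree t ≤ n := by
  classical
  refine Finset.sup_le fun i hi => ?_
  by_contra h
  refine (DFinsupp.mem_support_toFun _ _).1 hi (Subtype.ext ?_)
  exact 𝒯.comp_eq_zero_of_mem_filt ht (not_le.1 h)

/-- The homogenization `t ↦ ∑ᵢ tᵢ z^{n - i}` with respect to a prescribed degree `n`; it is
meaningful for `t ∈ T^{≤ n}`. -/
def homogenizeAt (n : ℕ) : T →+ T[X] where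
  toFun t := reflect n (𝒯.coaction t)
  map_zero' := by simp
  map_add' s t := by rw [map_add, reflect_add]

theorem homogenizeAt_of_mem {t : T} {i n : ℕ} (ht : t ∈ 𝒯.deg i) (h : i ≤ n) :
    𝒯.homogenizeAt n t = C t * X ^ (n - i) := by
  change reflect n (𝒯.coaction t) = _
  rw [𝒯.coaction_of_mem ht, ← C_mul_X_pow_eq_monomial, reflect_C_mul_X_pow, revAt_le h]

theorem homogenizeAt_mul {a b : T} {i j : ℕ} (ha : a ∈ 𝒯.filt i) (hb : b ∈ 𝒯.filt j) :
    𝒯.homogenizeAt (i + j) (a * b) = 𝒯.homogenizeAt i a * 𝒯.homogenizeAt j b := by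
  change reflect (i + j) (𝒯.coaction (a * b)) = _
  rw [map_mul, reflect_mul _ _ (𝒯.natDegree_coaction_le ha) (𝒯.natDegree_coaction_le hb)]
  rfl

theorem homogenizeAt_succ {a : T} {i : ℕ} (ha : a ∈ 𝒯.filt i) :
    𝒯.homogenizeAt (i + 1) a = X * 𝒯.homogenizeAt i a := by
  have := 𝒯.homogenizeAt_mul ha (𝒯.one_mem_filt 1)
  rw [mul_one, 𝒯.homogenizeAt_of_mem 𝒯.one_mem_deg zero_le_one] at this
  simpa [X_mul] using this

theorem homogenizeAt_add_degree {a : T} {i : ℕ} (ha : a ∈ 𝒯.filt i) (k : ℕ) :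
    𝒯.homogenizeAt (i + k) a = X ^ k * 𝒯.homogenizeAt i a := by
  induction k with
  | zero => simp
  | succ k ih =>
    rw [← add_assoc, 𝒯.homogenizeAt_succ (𝒯.filt_mono (Nat.le_add_right i k) ha), ih, pow_succ',
      mul_assoc]

theorem coeff_zero_homogenizeAt (t : T) (n : ℕ) : (𝒯.homogenizeAt n t).coeff 0 = 𝒯.comp t n := by
  change (reflect n (𝒯.coaction t)).coeff 0 = _
  rw [coeff_reflect, revAt_zero, coeff_coaction]

theorem homogenize_eq (t : T) : 𝒯.homogenize t = 𝒯.homogenizeAt (𝒯.topDegree t) t := by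
  conv_rhs => arg 2; rw [← 𝒯.sum_comp (t := t) (n := 𝒯.topDegree t)
    (fun i => SSubbimodule.comp_eq_zero_of_topDegree_lt)]
  rw [map_sum]
  exact Finset.sum_congr rfl fun i hi =>
    (𝒯.homogenizeAt_of_mem (𝒯.comp_mem t i) (Nat.lt_succ_iff.1 (Finset.mem_range.1 hi))).symm

theorem monomial_mem_polyDeg {t : T} {i j n : ℕ} (ht : t ∈ 𝒯.deg i) (h : i + j = n) :
    C t * X ^ j ∈ 𝒯.polyDeg n :=
  AddSubgroup.subset_closure ⟨i, j, h, t, ht, rfl⟩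

theorem homogenizeAt_mem {t : T} {n : ℕ} (ht : t ∈ 𝒯.filt n) :
    𝒯.homogenizeAt n t ∈ 𝒯.polyDeg n := by
  have : 𝒯.filt n ≤ (𝒯.polyDeg n).comap (𝒯.homogenizeAt n) := iSup₂_le fun i hi t ht => by
    rw [AddSubgroup.mem_comap, 𝒯.homogenizeAt_of_mem ht hi]
    exact 𝒯.monomial_mem_polyDeg ht (Nat.add_sub_of_le hi)
  exact this ht

theorem mul_mem_polyDeg {F G : T[X]} {i j : ℕ} (hF : F ∈ 𝒯.polyDeg i) (hG : G ∈ 𝒯.polyDeg j) :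
    F * G ∈ 𝒯.polyDeg (i + j) := by
  induction hF using AddSubgroup.closure_induction with
  | zero => simp
  | neg x _ hx => rw [neg_mul]; exact neg_mem hx
  | add x y _ _ hx hy => rw [add_mul]; exact add_mem hx hy
  | mem x hx =>
    obtain ⟨k, l, rfl, t, ht, rfl⟩ := hx
    induction hG using AddSubgroup.closure_induction with
    | zero => simp
    | neg x _ hx => rw [mul_neg]; exact neg_mem hx
    | add x y _ _ hx hy => rw [mul_add]; exact add_mem hx hy
    | mem x hx =>
      obtain ⟨k', l', rfl, t', ht', rfl⟩ := hx
      have : C t * X ^ l * (C t' * X ^ l') = C (t * t') * X ^ (l + l') := by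
        rw [mul_assoc, ← mul_assoc (X ^ l), X_pow_mul_C, C_mul, pow_add]
        simp only [mul_assoc]
      rw [this]
      exact 𝒯.monomial_mem_polyDeg (SetLike.mul_mem_graded ht ht') (by omega)

/-- The ring homomorphism `T[z] → T[X]` with `t ↦ t Xⁱ` for `t ∈ Tⁱ` and `z ↦ X`. It identifies
`T[z]` with the Rees ring `⨁ₙ T^{≤ n} Xⁿ`, and the coefficient of `Xⁿ` of the image of `F` is the
homogeneous component of degree `n` of `F`, evaluated at `z = 1`. -/
def rees : T[X] →+* T[X] := eval₂RingHom' 𝒯.coaction X fun _ => (commute_X _).symm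

@[simp] theorem rees_C (t : T) : 𝒯.rees (C t) = 𝒯.coaction t := by simp [rees, eval₂RingHom']

@[simp] theorem rees_X : 𝒯.rees X = X := by simp [rees, eval₂RingHom']

theorem rees_monomial {t : T} {i : ℕ} (ht : t ∈ 𝒯.deg i) (j : ℕ) :
    𝒯.rees (C t * X ^ j) = monomial (i + j) t := by
  rw [map_mul, map_pow, rees_C, rees_X, 𝒯.coaction_of_mem ht, monomial_mul_X_pow]

theorem poly_induction {p : T[X] → Prop} (h : ∀ i j, ∀ t ∈ 𝒯.deg i, p (C t * X ^ j))
    (hadd : ∀ F G, p F → p G → p (F + G)) (F : T[X]) : p F := by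
  induction F using Polynomial.induction_on' with
  | add F G hF hG => exact hadd F G hF hG
  | monomial n a =>
    induction a using 𝒯.homogeneous_induction with
    | h i t ht => rw [← C_mul_X_pow_eq_monomial]; exact h i n t ht
    | hadd s t hs ht => rw [map_add]; exact hadd _ _ hs ht

theorem rees_homogenizeAt {t : T} {n : ℕ} (ht : t ∈ 𝒯.filt n) :
    𝒯.rees (𝒯.homogenizeAt n t) = monomial n t := by
  have : 𝒯.filt n ≤ (((𝒯.rees : T[X] →+ T[X]).comp (𝒯.homogenizeAt n)).eqLocus
      (monomial n : T →ₗ[T] T[X]).toAddMonoidHom) := iSup₂_le fun i hi t ht => by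
    change 𝒯.rees (𝒯.homogenizeAt n t) = monomial n t
    rw [𝒯.homogenizeAt_of_mem ht hi, 𝒯.rees_monomial ht, Nat.add_sub_of_le hi]
  exact this ht

theorem coeff_rees_mem (F : T[X]) (n : ℕ) : (𝒯.rees F).coeff n ∈ 𝒯.filt n := by
  induction F using 𝒯.poly_induction with
  | hadd F G hF hG => rw [map_add, coeff_add]; exact add_mem hF hG
  | h i j t ht =>
    rw [𝒯.rees_monomial ht, coeff_monomial]
    split_ifs with h
    · exact 𝒯.deg_le_filt (by omega) ht
    · exact zero_mem _

/-- The homogeneous component of degree `n` of a polynomial in `T[z]`. -/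
def polyComp (n : ℕ) : T[X] →+ T[X] :=
  (𝒯.homogenizeAt n).comp ((lcoeff T n).toAddMonoidHom.comp (𝒯.rees : T[X] →+ T[X]))

theorem polyComp_apply (n : ℕ) (F : T[X]) :
    𝒯.polyComp n F = 𝒯.homogenizeAt n ((𝒯.rees F).coeff n) := rfl

theorem polyComp_mem (n : ℕ) (F : T[X]) : 𝒯.polyComp n F ∈ 𝒯.polyDeg n :=
  𝒯.homogenizeAt_mem (𝒯.coeff_rees_mem F n)

theorem polyComp_monomial {t : T} {i j : ℕ} (ht : t ∈ 𝒯.deg i) (n : ℕ) :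
    𝒯.polyComp n (C t * X ^ j) = if i + j = n then C t * X ^ j else 0 := by
  rw [polyComp_apply, 𝒯.rees_monomial ht, coeff_monomial]
  split_ifs with h
  · rw [𝒯.homogenizeAt_of_mem ht (by omega)]
    congr 2
    omega
  · exact map_zero _

theorem polyComp_of_mem {F : T[X]} {n : ℕ} (hF : F ∈ 𝒯.polyDeg n) (m : ℕ) :
    𝒯.polyComp m F = if n = m then F else 0 := by
  induction hF using AddSubgroup.closure_induction with
  | zero => simp
  | neg x _ hx => rw [map_neg, hx]; split_ifs <;> simp
  | add x y _ _ hx hy => rw [map_add, hx, hy]; split_ifs <;> simp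
  | mem x hx =>
    obtain ⟨k, l, rfl, t, ht, rfl⟩ := hx
    exact 𝒯.polyComp_monomial ht m

theorem rees_of_mem {F : T[X]} {n : ℕ} (hF : F ∈ 𝒯.polyDeg n) :
    𝒯.rees F = monomial n ((𝒯.rees F).coeff n) := by
  induction hF using AddSubgroup.closure_induction with
  | zero => simp
  | neg x _ hx => rw [map_neg, hx]; simp
  | add x y _ _ hx hy => rw [map_add, hx, hy]; simp
  | mem x hx =>
    obtain ⟨k, l, rfl, t, ht, rfl⟩ := hx
    rw [𝒯.rees_monomial ht]
    simp

theorem coeff_rees_mul (F : T[X]) {G : T[X]} {j : ℕ} (hG : G ∈ 𝒯.polyDeg j) (i : ℕ) :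
    (𝒯.rees (F * G)).coeff (i + j) = (𝒯.rees F).coeff i * (𝒯.rees G).coeff j := by
  rw [map_mul, 𝒯.rees_of_mem hG, coeff_mul_monomial]
  simp

theorem polyComp_mul (F : T[X]) {G : T[X]} {j : ℕ} (hG : G ∈ 𝒯.polyDeg j) (i : ℕ) :
    𝒯.polyComp (i + j) (F * G) = 𝒯.polyComp i F * G := by
  rw [polyComp_apply, 𝒯.coeff_rees_mul F hG,
    𝒯.homogenizeAt_mul (𝒯.coeff_rees_mem F i) (𝒯.coeff_rees_mem G j), ← polyComp_apply,
    ← polyComp_apply, 𝒯.polyComp_of_mem hG, if_pos rfl]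

theorem polyComp_mul_of_lt (F : T[X]) {G : T[X]} {j k : ℕ} (hG : G ∈ 𝒯.polyDeg j) (h : k < j) :
    𝒯.polyComp k (F * G) = 0 := by
  rw [polyComp_apply, map_mul, 𝒯.rees_of_mem hG, ← C_mul_X_pow_eq_monomial, ← mul_assoc,
    coeff_mul_X_pow', if_neg (by omega), map_zero]

/-- A subgroup of `T[z]` containing all homogeneous components of `F` contains `F`. -/
theorem mem_of_polyComp_mem (I : AddSubgroup T[X]) (F : T[X]) (h : ∀ n, 𝒯.polyComp n F ∈ I) :
    F ∈ I := by
  have key : ∀ F : T[X], (𝒯.rees F).sum (fun n a => 𝒯.homogenizeAt n a) = F := fun F => by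
    induction F using 𝒯.poly_induction with
    | hadd F G hF hG =>
      rw [map_add, sum_add_index _ _ _ (by simp) (by simp), hF, hG]
    | h i j t ht =>
      rw [𝒯.rees_monomial ht, sum_monomial_index _ _ (by simp),
        𝒯.homogenizeAt_of_mem ht (Nat.le_add_right i j), Nat.add_sub_cancel_left]
  rw [← key F]
  exact sum_mem fun n _ => h n

theorem X_mem_polyDeg : (X : T[X]) ∈ 𝒯.polyDeg 1 := by
  simpa using 𝒯.monomial_mem_polyDeg 𝒯.one_mem_deg (zero_add 1)

theorem C_mem_polyDeg {t : T} {i : ℕ} (ht : t ∈ 𝒯.deg i) : C t ∈ 𝒯.polyDeg i := by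
  simpa using 𝒯.monomial_mem_polyDeg ht (add_zero i)

end ConnGradedRing

/-! ### The filtration `Pₙ` and the ideal `⟨P*⟩` -/

namespace SSubbimodule

variable {S : Type*} {T : Type*} [Ring S] [Ring T] {𝒯 : ConnGradedRing S T} (P : SSubbimodule 𝒯)

theorem mem_jacFilt {a p b : T} {i j k n : ℕ} (ha : a ∈ 𝒯.filt i) (hp : p ∈ P.filt j)
    (hb : b ∈ 𝒯.filt k) (h : i + j + k = n) : a * p * b ∈ P.jacFilt n :=
  AddSubgroup.subset_closure ⟨i, j, k, h, a, ha, p, hp, b, hb, rfl⟩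

theorem mul_mem_jacFilt {a x : T} {i j : ℕ} (ha : a ∈ 𝒯.filt i) (hx : x ∈ P.jacFilt j) :
    a * x ∈ P.jacFilt (i + j) ∧ x * a ∈ P.jacFilt (j + i) := by
  induction hx using AddSubgroup.closure_induction with
  | zero => simp
  | neg x _ hx => rw [mul_neg, neg_mul]; exact ⟨neg_mem hx.1, neg_mem hx.2⟩
  | add x y _ _ hx hy =>
    rw [mul_add, add_mul]; exact ⟨add_mem hx.1 hy.1, add_mem hx.2 hy.2⟩
  | mem x hx =>
    obtain ⟨k, l, m, rfl, c, hc, p, hp, b, hb, rfl⟩ := hx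
    constructor
    · rw [← mul_assoc, ← mul_assoc]
      exact P.mem_jacFilt (𝒯.mul_mem_filt ha hc) hp hb (by omega)
    · rw [mul_assoc]
      exact P.mem_jacFilt hc hp (𝒯.mul_mem_filt hb ha) (by omega)

theorem jacFilt_mono {m n : ℕ} (h : m ≤ n) : P.jacFilt m ≤ P.jacFilt n := fun x hx => by
  obtain ⟨k, rfl⟩ := Nat.exists_eq_add_of_le h
  simpa using (P.mul_mem_jacFilt (𝒯.one_mem_filt k) hx).2

theorem jacFilt_le_idealP {x : T} {n : ℕ} (hx : x ∈ P.jacFilt n) : x ∈ P.idealP := by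
  induction hx using AddSubgroup.closure_induction with
  | zero => exact zero_mem _
  | neg x _ hx => exact neg_mem hx
  | add x y _ _ hx hy => exact add_mem hx hy
  | mem x hx =>
    obtain ⟨k, l, m, rfl, c, hc, p, hp, b, hb, rfl⟩ := hx
    exact TwoSidedIdeal.mul_mem_right _ _ _
      (TwoSidedIdeal.mul_mem_left _ _ _ (TwoSidedIdeal.subset_span hp.1))

theorem mem_jacFilt_topDegree {p : T} (hp : p ∈ P.toAddSubgroup) :
    p ∈ P.jacFilt (𝒯.topDegree p) := by
  have := P.mem_jacFilt (𝒯.one_mem_filt 0) ⟨hp, 𝒯.mem_filt_topDegree p⟩ (𝒯.one_mem_filt 0) rfl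
  simpa using this

theorem exists_mem_jacFilt {x : T} (hx : x ∈ P.idealP) : ∃ n, x ∈ P.jacFilt n := by
  induction hx using TwoSidedIdeal.span_induction with
  | mem p hp => exact ⟨_, P.mem_jacFilt_topDegree hp⟩
  | zero => exact ⟨0, zero_mem _⟩
  | add x y _ _ hx hy =>
    obtain ⟨m, hm⟩ := hx
    obtain ⟨n, hn⟩ := hy
    exact ⟨m + n, add_mem (P.jacFilt_mono (by omega) hm) (P.jacFilt_mono (by omega) hn)⟩
  | neg x _ hx => exact hx.imp fun n hn => neg_mem hn
  | left_absorb a x _ hx =>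
    obtain ⟨n, hn⟩ := hx
    exact ⟨_, (P.mul_mem_jacFilt (𝒯.mem_filt_topDegree a) hn).1⟩
  | right_absorb a x _ hx =>
    obtain ⟨n, hn⟩ := hx
    exact ⟨_, (P.mul_mem_jacFilt (𝒯.mem_filt_topDegree a) hn).2⟩

theorem homogenizeAt_mem_idealStar {x : T} {n : ℕ} (hx : x ∈ P.jacFilt n) :
    𝒯.homogenizeAt n x ∈ P.idealStar := by
  induction hx using AddSubgroup.closure_induction with
  | zero => rw [map_zero]; exact zero_mem _
  | neg x _ hx => rw [map_neg]; exact neg_mem hx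
  | add x y _ _ hx hy => rw [map_add]; exact add_mem hx hy
  | mem x hx =>
    obtain ⟨k, l, m, rfl, c, hc, p, hp, b, hb, rfl⟩ := hx
    rw [𝒯.homogenizeAt_mul (𝒯.mul_mem_filt hc hp.2) hb, 𝒯.homogenizeAt_mul hc hp.2]
    refine TwoSidedIdeal.mul_mem_right _ _ _ (TwoSidedIdeal.mul_mem_left _ _ _ ?_)
    obtain ⟨k, rfl⟩ := Nat.exists_eq_add_of_le (𝒯.topDegree_le hp.2)
    rw [𝒯.homogenizeAt_add_degree (𝒯.mem_filt_topDegree p), ← 𝒯.homogenize_eq]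
    exact TwoSidedIdeal.mul_mem_left _ _ _ (TwoSidedIdeal.subset_span ⟨p, hp.1, rfl⟩)

/-- Under the identification of `T[z]` with the Rees ring of `T`, the ideal `⟨P*⟩` corresponds to
`⨁ₙ Pₙ Xⁿ`; hence `Dⁿ = T^{≤ n} / Pₙ`. -/
theorem mem_idealStar_iff_coeff {F : T[X]} :
    F ∈ P.idealStar ↔ ∀ n, (𝒯.rees F).coeff n ∈ P.jacFilt n := by
  constructor
  · intro hF
    induction hF using TwoSidedIdeal.span_induction with
    | mem p hp =>
      obtain ⟨p, hp, rfl⟩ := hp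
      intro n
      -- `p*` corresponds to `p Xᵈ`, where `d` is the top degree of `p`.
      rw [𝒯.homogenize_eq, 𝒯.rees_homogenizeAt (𝒯.mem_filt_topDegree p), coeff_monomial]
      split_ifs with h
      · exact h ▸ P.mem_jacFilt_topDegree hp
      · exact zero_mem _
    | zero => simp
    | add x y _ _ hx hy => intro n; rw [map_add, coeff_add]; exact add_mem (hx n) (hy n)
    | neg x _ hx => intro n; rw [map_neg, coeff_neg]; exact neg_mem (hx n)
    | left_absorb a x _ hx =>
      intro n
      rw [map_mul, coeff_mul]
      refine sum_mem fun ij hij => ?_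
      rw [← Finset.HasAntidiagonal.mem_antidiagonal.1 hij]
      exact (P.mul_mem_jacFilt (𝒯.coeff_rees_mem a _) (hx _)).1
    | right_absorb a x _ hx =>
      intro n
      rw [map_mul, coeff_mul]
      refine sum_mem fun ij hij => ?_
      rw [← Finset.HasAntidiagonal.mem_antidiagonal.1 hij]
      exact (P.mul_mem_jacFilt (𝒯.coeff_rees_mem a _) (hx _)).2
  · intro h
    rw [← TwoSidedIdeal.mem_asIdeal]
    exact 𝒯.mem_of_polyComp_mem P.idealStar.asIdeal.toAddSubgroup F fun n =>
      TwoSidedIdeal.mem_asIdeal.2 (P.homogenizeAt_mem_idealStar (h n))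

theorem X_mul_mem_idealStar_iff {F : T[X]} :
    X * F ∈ P.idealStar ↔ ∀ n, (𝒯.rees F).coeff n ∈ P.jacFilt (n + 1) := by
  rw [mem_idealStar_iff_coeff, map_mul, 𝒯.rees_X]
  constructor
  · intro h n
    simpa using h (n + 1)
  · rintro h (_ | n)
    · simp
    · simpa using h n

/-! ### Regularity of `z`, the Jacobi conditions and the PBW property -/

theorem z_mul_mkD_eq_zero_iff {F : T[X]} : P.z * P.mkD F = 0 ↔ X * F ∈ P.idealStar := by
  rw [z, ← map_mul, mem_idealStar_iff]

variable {P} in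
/-- Since `Dⁿ = T^{≤ n} / Pₙ` with `z : Dⁿ → Dⁿ⁺¹` induced by the inclusion `T^{≤ n} ⊆ T^{≤ n + 1}`,
`(Jₙ)` says that `z` acts injectively on `Dⁿ`. -/
theorem Jacobi.eq_zero_of_z_mul {n : ℕ} (h : P.Jacobi n) {d : P.D} (hd : d ∈ P.degD n)
    (hz : P.z * d = 0) : d = 0 := by
  obtain ⟨F, hF, rfl⟩ := hd
  change P.z * P.mkD F = 0 at hz
  change P.mkD F = 0
  rw [z_mul_mkD_eq_zero_iff, X_mul_mem_idealStar_iff] at hz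
  rw [mem_idealStar_iff, ← 𝒯.polyComp_of_mem hF n |>.trans (if_pos rfl)]
  exact P.homogenizeAt_mem_idealStar (h ⟨hz n, 𝒯.coeff_rees_mem F n⟩)

theorem z_regular_iff_forall_jacobi :
    (∀ d : P.D, P.z * d = 0 → d = 0) ↔ ∀ n, P.Jacobi n := by
  constructor
  · rintro h n x ⟨hx, hxn⟩
    have h1 : 𝒯.homogenizeAt n x ∈ P.idealStar := by
      rw [← mem_idealStar_iff]
      refine h _ (P.z_mul_mkD_eq_zero_iff.2 ?_)
      rw [← 𝒯.homogenizeAt_succ hxn]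
      exact P.homogenizeAt_mem_idealStar hx
    simpa [𝒯.rees_homogenizeAt hxn] using P.mem_idealStar_iff_coeff.1 h1 n
  · intro h d hd
    obtain ⟨F, rfl⟩ : ∃ F, P.mkD F = d := Ideal.Quotient.mk_surjective d
    rw [z_mul_mkD_eq_zero_iff, X_mul_mem_idealStar_iff] at hd
    rw [mem_idealStar_iff, mem_idealStar_iff_coeff]
    exact fun n => h n ⟨hd n, 𝒯.coeff_rees_mem F n⟩

/-- An element of `⟨R_P⟩ ⊆ T` lies in `⟨P*⟩ + z T[z]`; in other words, `ker π = z D`. -/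
theorem exists_sub_mem_idealStar {t : T} (ht : t ∈ P.idealR) :
    ∃ G, C t - X * G ∈ P.idealStar := by
  induction ht using TwoSidedIdeal.span_induction with
  | mem x hx =>
    obtain ⟨n, -, p, hp, rfl⟩ := hx
    refine ⟨-(𝒯.homogenize p).divX, ?_⟩
    have h : C (𝒯.leadHom p) - X * -(𝒯.homogenize p).divX = 𝒯.homogenize p := by
      rw [mul_neg, sub_neg_eq_add, X_mul, add_comm, ← constantCoeff_homogenize]
      exact divX_mul_X_add _
    rw [h]
    exact TwoSidedIdeal.subset_span ⟨p, hp, rfl⟩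
  | zero => exact ⟨0, by simp⟩
  | add x y _ _ hx hy =>
    obtain ⟨G, hG⟩ := hx
    obtain ⟨H, hH⟩ := hy
    refine ⟨G + H, ?_⟩
    have := add_mem hG hH
    rwa [sub_add_sub_comm, ← C_add, ← mul_add] at this
  | neg x _ hx =>
    obtain ⟨G, hG⟩ := hx
    refine ⟨-G, ?_⟩
    have := neg_mem hG
    rwa [neg_sub', ← C_neg, ← mul_neg] at this
  | left_absorb a x _ hx =>
    obtain ⟨G, hG⟩ := hx
    refine ⟨C a * G, ?_⟩
    have := TwoSidedIdeal.mul_mem_left _ (C a) _ hG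
    rwa [mul_sub, ← C_mul, ← mul_assoc, ← X_mul, mul_assoc] at this
  | right_absorb a x _ hx =>
    obtain ⟨G, hG⟩ := hx
    refine ⟨G * C a, ?_⟩
    have := TwoSidedIdeal.mul_mem_right _ _ (C a) hG
    rwa [sub_mul, ← C_mul, mul_assoc] at this

/-- The ideal `⟨R_P⟩` in degree `n` is the image of `Pₙ` in `Tⁿ = T^{≤ n} / T^{≤ n - 1}`. -/
theorem mem_idealR_iff_exists {x : T} {n : ℕ} (hx : x ∈ 𝒯.deg n) :
    x ∈ P.idealR ↔ ∃ p ∈ P.jacFilt n, x - p ∈ 𝒯.filtLT n := by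
  constructor
  · intro h
    obtain ⟨G, hG⟩ := P.exists_sub_mem_idealStar h
    have h1 := P.mem_idealStar_iff_coeff.1 hG n
    refine ⟨_, h1, ?_⟩
    rw [map_sub, coeff_sub, 𝒯.rees_C, 𝒯.coeff_coaction, 𝒯.comp_of_mem hx, if_pos rfl,
      sub_sub_cancel, map_mul, 𝒯.rees_X]
    cases n with
    | zero => simp
    | succ n =>
      rw [coeff_X_mul, 𝒯.filtLT_succ]
      exact 𝒯.coeff_rees_mem G n
  · rintro ⟨p, hp, hxp⟩
    have h1 := P.idealStar_le_comap (P.homogenizeAt_mem_idealStar hp)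
    rw [TwoSidedIdeal.mem_comap, constantCoeff_apply, 𝒯.coeff_zero_homogenizeAt] at h1
    have h2 : 𝒯.comp p n = x := by
      have h3 : 𝒯.comp (x - p + p) n = 𝒯.comp p n := by
        rw [𝒯.comp_add, 𝒯.comp_of_mem_filtLT hxp, zero_add]
      rw [← h3, sub_add_cancel, 𝒯.comp_of_mem hx, if_pos rfl]
    rwa [h2] at h1

theorem phiDeg_surjective (n : ℕ) : Function.Surjective (P.PhiDeg n) := by
  intro y
  obtain ⟨⟨_, t, ht, rfl⟩, rfl⟩ := QuotientAddGroup.mk'_surjective _ y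
  refine ⟨P.projA n ⟨𝒯.comp t n, 𝒯.comp_mem t n⟩, ?_⟩
  rw [PhiDeg_projA]
  refine (QuotientAddGroup.eq).2 ?_
  rw [AddSubgroup.mem_addSubgroupOf]
  refine ⟨t - 𝒯.comp t n, 𝒯.sub_comp_mem_filtLT ht, ?_⟩
  simp [sub_eq_neg_add]

/-- Injectivity of `Φ_Pⁿ`: `Tⁿ ∩ (⟨P⟩ + T^{≤ n - 1}) ⊆ Pₙ + T^{≤ n - 1}`. -/
theorem phiDeg_injective_iff (n : ℕ) : Function.Injective (P.PhiDeg n) ↔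
    ∀ x ∈ 𝒯.deg n, (∃ y ∈ 𝒯.filtLT n, x - y ∈ P.idealP) →
      ∃ p ∈ P.jacFilt n, x - p ∈ 𝒯.filtLT n := by
  have key : ∀ x : 𝒯.deg n, P.PhiDeg n (P.projA n x) = 0 ↔
      ∃ y ∈ 𝒯.filtLT n, (x : T) - y ∈ P.idealP := fun x => by
    rw [PhiDeg_projA]
    refine (QuotientAddGroup.eq_zero_iff _).trans (AddSubgroup.mem_addSubgroupOf.trans ?_)
    refine exists_congr fun y => and_congr_right fun _ => ?_
    rw [← mem_idealP_iff, map_sub, sub_eq_zero, eq_comm]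
    rfl
  have key2 : ∀ x : 𝒯.deg n, P.projA n x = 0 ↔ (x : T) ∈ P.idealR := fun x => by
    rw [← mem_idealR_iff]
    exact Subtype.ext_iff
  rw [injective_iff_map_eq_zero]
  constructor
  · intro h x hx hy
    rw [← P.mem_idealR_iff_exists hx]
    exact (key2 ⟨x, hx⟩).1 (h _ ((key ⟨x, hx⟩).2 hy))
  · intro h a ha
    obtain ⟨x, rfl⟩ := P.projA_surjective n a
    exact (key2 x).2 ((P.mem_idealR_iff_exists x.2).2 (h x x.2 ((key x).1 ha)))

/-- Injectivity of `Φ_P` in all degrees amounts to `⟨P⟩ ∩ T^{≤ n} = Pₙ` for all `n`, and, as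
`⟨P⟩ = ⋃ₙ Pₙ`, this is the conjunction of the Jacobi conditions. -/
theorem pbwType_iff_forall_jacobi : P.PBWType ↔ ∀ n, P.Jacobi n := by
  have h1 : P.PBWType ↔ ∀ n, Function.Injective (P.PhiDeg n) :=
    ⟨fun h => (DirectSum.map_injective _).1 h.1,
      fun h => ⟨(DirectSum.map_injective _).2 h,
        (DirectSum.map_surjective _).2 P.phiDeg_surjective⟩⟩
  simp only [h1, phiDeg_injective_iff]
  constructor
  · intro h
    have key : ∀ n, ∀ x ∈ 𝒯.filt n, x ∈ P.idealP → x ∈ P.jacFilt n := by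
      intro n
      induction n with
      | zero =>
        intro x hx hxP
        have h0 := 𝒯.sub_comp_mem_filtLT hx
        obtain ⟨p, hp, hxp⟩ := h 0 _ (𝒯.comp_mem x 0) ⟨-(x - 𝒯.comp x 0), neg_mem h0, by simpa⟩
        rw [𝒯.filtLT_zero, AddSubgroup.mem_bot, sub_eq_zero] at h0 hxp
        rwa [h0, hxp]
      | succ n ih =>
        intro x hx hxP
        have h0 := 𝒯.sub_comp_mem_filtLT hx
        obtain ⟨p, hp, hxp⟩ := h (n + 1) _ (𝒯.comp_mem x _)
          ⟨-(x - 𝒯.comp x _), neg_mem h0, by simpa⟩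
        have h2 := add_mem h0 hxp
        rw [sub_add_sub_cancel, 𝒯.filtLT_succ] at h2
        have h3 := ih _ h2 (sub_mem hxP (P.jacFilt_le_idealP hp))
        simpa using add_mem (P.jacFilt_mono n.le_succ h3) hp
    rintro n x ⟨hx, hxn⟩
    exact key n x hxn (P.jacFilt_le_idealP hx)
  · rintro h n x hx ⟨y, hy, hxy⟩
    -- `⟨P⟩ = ⋃ₘ Pₘ`, and the Jacobi conditions allow to descend from `Pₘ` to `Pₙ`.
    have key : ∀ k, ∀ t ∈ P.jacFilt (n + k), t ∈ 𝒯.filt n → t ∈ P.jacFilt n := by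
      intro k
      induction k with
      | zero => exact fun t ht _ => ht
      | succ k ih =>
        exact fun t ht htn =>
          ih t (h (n + k) ⟨ht, 𝒯.filt_mono (Nat.le_add_right n k) htn⟩) htn
    obtain ⟨m, hm⟩ := P.exists_mem_jacFilt hxy
    refine ⟨x - y, key m _ (P.jacFilt_mono (Nat.le_add_left m n) hm)
      (sub_mem (𝒯.deg_le_filt le_rfl hx) (𝒯.filtLT_le_filt n hy)), ?_⟩
    rwa [sub_sub_cancel]

/-- `P` is of PBW-type if and only if `z` is a regular element of `D`. -/
theorem pbwType_iff_z_regular : P.PBWType ↔ ∀ d : P.D, P.z * d = 0 → d = 0 :=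
  P.pbwType_iff_forall_jacobi.trans P.z_regular_iff_forall_jacobi.symm

theorem exists_z_mul_of_piDA_eq_zero {d : P.D} (hd : P.piDA d = 0) : ∃ e, d = P.z * e := by
  obtain ⟨F, rfl⟩ : ∃ F, P.mkD F = d := Ideal.Quotient.mk_surjective d
  rw [piDA_mkD, mem_idealR_iff] at hd
  obtain ⟨G, hG⟩ := P.exists_sub_mem_idealStar hd
  refine ⟨P.mkD (G + F.divX), ?_⟩
  rw [z, ← map_mul, ← sub_eq_zero, ← map_sub, mem_idealStar_iff]
  convert hG using 1
  conv_lhs => arg 1; rw [← F.divX_mul_X_add]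
  rw [mul_add, X_mul (p := F.divX), constantCoeff_apply]
  abel

theorem piDA_z : P.piDA P.z = 0 := by
  rw [z, piDA_mkD]
  simp

/-! ### The grading of `D` -/

theorem mkD_surjective : Function.Surjective (P.mkD : T[X] →+ P.D) := Ideal.Quotient.mk_surjective

theorem polyComp_mem_idealStar (n : ℕ) {F : T[X]} (hF : F ∈ P.idealStar) :
    𝒯.polyComp n F ∈ P.idealStar :=
  P.homogenizeAt_mem_idealStar (P.mem_idealStar_iff_coeff.1 hF n)

/-- The projection of `D` onto its homogeneous component of degree `n`. -/
def compD (n : ℕ) : P.D →+ P.D :=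
  (P.mkD : T[X] →+ P.D).liftOfSurjective P.mkD_surjective
    ⟨(P.mkD : T[X] →+ P.D).comp (𝒯.polyComp n), fun F hF =>
      (P.mem_idealStar_iff _).2 (P.polyComp_mem_idealStar n ((P.mem_idealStar_iff F).1 hF))⟩

theorem compD_mkD (n : ℕ) (F : T[X]) : P.compD n (P.mkD F) = P.mkD (𝒯.polyComp n F) :=
  AddMonoidHom.liftOfRightInverse_comp_apply _ _ _
    ⟨(P.mkD : T[X] →+ P.D).comp (𝒯.polyComp n), _⟩ F

theorem compD_mem (n : ℕ) (d : P.D) : P.compD n d ∈ P.degD n := by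
  obtain ⟨F, rfl⟩ := P.mkD_surjective d
  exact ⟨_, 𝒯.polyComp_mem n F, (P.compD_mkD n F).symm⟩

theorem compD_of_mem {d : P.D} {n : ℕ} (hd : d ∈ P.degD n) (m : ℕ) :
    P.compD m d = if n = m then d else 0 := by
  obtain ⟨F, hF, rfl⟩ := hd
  refine (P.compD_mkD m F).trans ?_
  rw [𝒯.polyComp_of_mem hF]
  split_ifs
  · rfl
  · exact map_zero _

/-- Only the right factor has to be homogeneous. This applies to `e = z`, to `e ∈ S`, and to
`e ∈ D¹`. -/
theorem compD_mul (d : P.D) {e : P.D} {j : ℕ} (he : e ∈ P.degD j) (i : ℕ) :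
    P.compD (i + j) (d * e) = P.compD i d * e := by
  obtain ⟨F, rfl⟩ := P.mkD_surjective d
  obtain ⟨G, hG, rfl⟩ := he
  change P.compD (i + j) (P.mkD F * P.mkD G) = P.compD i (P.mkD F) * P.mkD G
  rw [← map_mul, compD_mkD, compD_mkD, ← map_mul, 𝒯.polyComp_mul F hG]

theorem compD_mul_of_lt (d : P.D) {e : P.D} {j k : ℕ} (he : e ∈ P.degD j) (h : k < j) :
    P.compD k (d * e) = 0 := by
  obtain ⟨F, rfl⟩ := P.mkD_surjective d
  obtain ⟨G, hG, rfl⟩ := he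
  change P.compD k (P.mkD F * P.mkD G) = 0
  rw [← map_mul, compD_mkD, 𝒯.polyComp_mul_of_lt F hG h, map_zero]

theorem eq_zero_of_compD_eq_zero {d : P.D} (h : ∀ n, P.compD n d = 0) : d = 0 := by
  obtain ⟨F, rfl⟩ := P.mkD_surjective d
  refine 𝒯.mem_of_polyComp_mem (P.mkD : T[X] →+ P.D).ker F fun n => ?_
  exact (P.compD_mkD n F).symm.trans (h n)

theorem mul_mem_degD {d e : P.D} {i j : ℕ} (hd : d ∈ P.degD i) (he : e ∈ P.degD j) :
    d * e ∈ P.degD (i + j) := by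
  obtain ⟨F, hF, rfl⟩ := hd
  obtain ⟨G, hG, rfl⟩ := he
  exact ⟨F * G, 𝒯.mul_mem_polyDeg hF hG, map_mul P.mkD F G⟩

theorem unitD_mem (s : S) : P.unitD s ∈ P.degD 0 :=
  ⟨_, 𝒯.C_mem_polyDeg (𝒯.ι_mem_deg s), rfl⟩

theorem one_mem_degD : (1 : P.D) ∈ P.degD 0 := by
  simpa using P.unitD_mem 1

theorem z_mem_degD : P.z ∈ P.degD 1 := ⟨_, 𝒯.X_mem_polyDeg, rfl⟩

/-- Every homogeneous element of `A` lifts to a homogeneous element of `D` of the same degree. -/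
theorem exists_mem_degD_of_mem_degA {a : P.A} {n : ℕ} (ha : a ∈ P.degA n) :
    ∃ d ∈ P.degD n, P.piDA d = a := by
  obtain ⟨t, ht, rfl⟩ := ha
  refine ⟨_, ⟨C t, 𝒯.C_mem_polyDeg ht, rfl⟩, ?_⟩
  exact (P.piDA_mkD _).trans (by simp)

end SSubbimodule

/-! ### Graded projective modules -/

section Graded

variable {S V : Type*} [Ring S] [AddCommGroup V] [Module S V] {gr : ℕ → Submodule S V}

/-- The projection of an internally graded module onto its component of degree `i`. -/
def gradedProj (h : DirectSum.IsInternal gr) (i : ℕ) : V →ₗ[S] V :=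
  (gr i).subtype ∘ₗ DirectSum.component S ℕ (fun i => gr i) i ∘ₗ
    (LinearEquiv.ofBijective (DirectSum.coeLinearMap gr) h).symm.toLinearMap

theorem gradedProj_mem (h : DirectSum.IsInternal gr) (i : ℕ) (v : V) : gradedProj h i v ∈ gr i :=
  SetLike.coe_mem _

theorem ofBijective_symm_of_mem (h : DirectSum.IsInternal gr) {i : ℕ} {v : V} (hv : v ∈ gr i) :
    (LinearEquiv.ofBijective (DirectSum.coeLinearMap gr) h).symm v =
      DirectSum.lof S ℕ (fun i => gr i) i ⟨v, hv⟩ := by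
  rw [LinearEquiv.symm_apply_eq]
  exact (DirectSum.coeLinearMap_lof gr i ⟨v, hv⟩).symm

theorem gradedProj_of_mem (h : DirectSum.IsInternal gr) {i : ℕ} {v : V} (hv : v ∈ gr i) (j : ℕ) :
    gradedProj h j v = if i = j then v else 0 := by
  simp only [gradedProj, LinearMap.comp_apply, LinearEquiv.coe_coe,
    ofBijective_symm_of_mem h hv]
  split_ifs with hij
  · subst hij
    rw [DirectSum.component.lof_self]
    rfl
  · rw [DirectSum.component.of, dif_neg hij, map_zero]

theorem graded_induction (h : DirectSum.IsInternal gr) {p : V → Prop}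
    (hmem : ∀ i, ∀ v ∈ gr i, p v) (hadd : ∀ v w, p v → p w → p (v + w)) (v : V) : p v := by
  have hv : v ∈ ⨆ i, gr i := h.submodule_iSup_eq_top ▸ Submodule.mem_top
  induction hv using Submodule.iSup_induction' with
  | mem i x hx => exact hmem i x hx
  | zero => exact hmem 0 0 (zero_mem _)
  | add x y _ _ hx hy => exact hadd x y hx hy

/-- A graded projective module has the lifting property with respect to graded maps. The target
`N` carries submodules `Q i` in place of a grading. -/
theorem exists_graded_lift {N N' : Type*} [AddCommGroup N] [AddCommGroup N'] [Module S N]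
    [Module S N'] (hgr : DirectSum.IsInternal gr) [Module.Projective S V] (q : N →ₗ[S] N')
    (h : V →ₗ[S] N') (Q : ℕ → Submodule S N) (H : ∀ i, ∀ v ∈ gr i, ∃ n ∈ Q i, q n = h v) :
    ∃ F : V →ₗ[S] N, ∀ i, ∀ v ∈ gr i, F v ∈ Q i ∧ q (F v) = h v := by
  have hproj : ∀ i, Module.Projective S (gr i) := fun i =>
    Module.Projective.of_split (gr i).subtype
      ((gradedProj hgr i).codRestrict (gr i) (gradedProj_mem hgr i)) (by
        ext v
        simp [gradedProj_of_mem hgr v.2])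
  have hF : ∀ i, ∃ F : gr i →ₗ[S] Q i, ∀ v, q (F v) = h v := fun i => by
    obtain ⟨F, hF⟩ := Module.projective_lifting_property (P := gr i)
      ((q ∘ₗ (Q i).subtype).rangeRestrict)
      ((h ∘ₗ (gr i).subtype).codRestrict _ (fun v => by
        obtain ⟨n, hn, hnv⟩ := H i v v.2
        exact ⟨(⟨n, hn⟩ : Q i), hnv⟩)) (LinearMap.surjective_rangeRestrict _)
    exact ⟨F, fun v => congrArg Subtype.val (LinearMap.congr_fun hF v)⟩
  choose F hF using hF
  refine ⟨DirectSum.toModule S ℕ N (fun i => (Q i).subtype ∘ₗ F i) ∘ₗ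
    (LinearEquiv.ofBijective (DirectSum.coeLinearMap gr) hgr).symm.toLinearMap, fun i v hv => ?_⟩
  rw [LinearMap.comp_apply, LinearEquiv.coe_coe, ofBijective_symm_of_mem hgr hv,
    DirectSum.toModule_lof]
  exact ⟨SetLike.coe_mem _, hF i ⟨v, hv⟩⟩

end Graded

/-! ### The tensor product `B ⊗_S V` -/

namespace BaseExt

variable {S : Type*} {B : Type*} {B' : Type*} [Ring S] [Ring B] [Ring B']
  (φ : S →+* B) (ψ : S →+* B') {V : Type*} [AddCommGroup V] [Module S V]

theorem mk_surjective : Function.Surjective (mk φ V) := Submodule.mkQ_surjective _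

theorem tmul_add (b : B) (v w : V) : tmul φ b (v + w) = tmul φ b v + tmul φ b w := by
  simp [tmul, TensorProduct.tmul_add]

theorem add_tmul (b c : B) (v : V) : tmul φ (b + c) v = tmul φ b v + tmul φ c v := by
  simp [tmul, TensorProduct.add_tmul]

@[simp] theorem tmul_zero (b : B) : tmul φ b (0 : V) = 0 := by simp [tmul]

@[simp] theorem zero_tmul (v : V) : tmul φ 0 v = 0 := by simp [tmul]

theorem smul_tmul (b c : B) (v : V) : b • tmul φ c v = tmul φ (b * c) v := by
  simp [tmul, ← map_smul, TensorProduct.smul_tmul']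

theorem smul_one_tmul (b : B) (v : V) : b • tmul φ 1 v = tmul φ b v := by
  rw [smul_tmul, mul_one]

theorem tmul_smul (b : B) (s : S) (v : V) : tmul φ b (s • v) = tmul φ (b * φ s) v :=
  ((Submodule.Quotient.eq (baseExtRel φ V)).2 (Submodule.subset_span ⟨b, s, v, rfl⟩)).symm

/-- The biadditive map `(b, v) ↦ b ⊗ v`. -/
def tmulHom : B →+ V →+ BaseExt φ V where
  toFun b := { toFun := tmul φ b, map_zero' := tmul_zero φ b, map_add' := tmul_add φ b }
  map_zero' := by ext v; exact zero_tmul φ v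
  map_add' b c := by ext v; exact add_tmul φ b c v

variable {φ} in
theorem induction {p : BaseExt φ V → Prop} (htmul : ∀ b v, p (tmul φ b v))
    (hadd : ∀ x y, p x → p y → p (x + y)) (x : BaseExt φ V) : p x := by
  obtain ⟨x, rfl⟩ := mk_surjective φ x
  induction x using TensorProduct.induction_on with
  | zero => simpa using htmul 0 0
  | tmul b v => exact htmul b v
  | add x y hx hy => rw [map_add]; exact hadd _ _ hx hy

/-- A biadditive map balanced over `S` induces an additive map on `B ⊗_S V`. -/
def liftAdd {M : Type*} [AddCommGroup M] (G : B →+ V →+ M)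
    (hG : ∀ b s v, G (b * φ s) v = G b (s • v)) : BaseExt φ V →+ M :=
  (mk φ V).toAddMonoidHom.liftOfSurjective (mk_surjective φ)
    ⟨(TensorProduct.liftAddHom G fun r b v => by simp [-zsmul_eq_mul]), fun x hx => by
      have hx' : x ∈ baseExtRel φ V := (Submodule.Quotient.mk_eq_zero _).1 hx
      have key : ∀ b : B,
          TensorProduct.liftAddHom G (fun r b v => by simp [-zsmul_eq_mul]) (b • x) = 0 := by
        clear hx
        induction hx' using Submodule.span_induction with
        | mem x hx =>
          obtain ⟨c, s, v, rfl⟩ := hx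
          intro b
          simp [smul_sub, TensorProduct.smul_tmul', ← mul_assoc, hG]
        | zero => simp
        | add x y _ _ hx hy => intro b; rw [smul_add, map_add, hx, hy, add_zero]
        | smul c x _ hx => intro b; rw [smul_smul, hx]
      simpa using key 1⟩

theorem liftAdd_tmul {M : Type*} [AddCommGroup M] (G : B →+ V →+ M)
    (hG : ∀ b s v, G (b * φ s) v = G b (s • v)) (b : B) (v : V) :
    liftAdd φ G hG (tmul φ b v) = G b v :=
  AddMonoidHom.liftOfRightInverse_comp_apply _ _ _ ⟨TensorProduct.liftAddHom G _, _⟩ (b ⊗ₜ[ℤ] v)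

/-- An `S`-linear map from `V` to a `B`-module induces a `B`-linear map on `B ⊗_S V`. -/
def lift {N : Type*} [AddCommGroup N] [Module B N] (F : V →+ N)
    (hF : ∀ s v, F (s • v) = φ s • F v) : BaseExt φ V →ₗ[B] N where
  __ := liftAdd φ (((AddMonoidHom.flip (smulAddHom B N)).comp F).flip)
    (fun b s v => by simp [hF, mul_smul])
  map_smul' b x := by
    change liftAdd φ _ _ (b • x) = b • liftAdd φ _ _ x
    induction x using BaseExt.induction with
    | htmul c v => rw [smul_tmul, liftAdd_tmul, liftAdd_tmul]; simp [mul_smul]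
    | hadd x y hx hy => rw [smul_add, map_add, hx, hy, map_add, smul_add]

theorem lift_tmul {N : Type*} [AddCommGroup N] [Module B N] (F : V →+ N)
    (hF : ∀ s v, F (s • v) = φ s • F v) (b : B) (v : V) :
    lift φ F hF (tmul φ b v) = b • F v :=
  (liftAdd_tmul φ (((AddMonoidHom.flip (smulAddHom B N)).comp F).flip)
    (fun b s v => by simp [hF, mul_smul]) b v).trans (by simp)

/-- The coordinates of an element of `B ⊗_S V` in the free `B`-module on the set `V`, for an
`S`-linear map `s` from `V` to the free `S`-module on `V`. When `s` is a section of the canonical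
projection, they exhibit `B ⊗_S V` as a direct summand of a free `B`-module. -/
def coord (s : V →ₗ[S] V →₀ S) : BaseExt φ V →ₗ[B] V →₀ B :=
  lift φ ((Finsupp.mapRange.addMonoidHom (φ : S →+ B)).comp s.toAddMonoidHom) fun c v => by
    ext w
    simp

theorem coord_tmul (s : V →ₗ[S] V →₀ S) (b : B) (v w : V) :
    coord φ s (tmul φ b v) w = b * φ (s v w) := by
  rw [coord, lift_tmul]
  simp

/-- For projective `V`, an element of `B ⊗_S V` is recovered from its coordinates. -/
theorem linearCombination_coord {s : V →ₗ[S] V →₀ S}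
    (hs : Function.LeftInverse (Finsupp.linearCombination S id) s) (x : BaseExt φ V) :
    Finsupp.linearCombination B (fun v : V => tmul φ 1 v) (coord φ s x) = x := by
  induction x using BaseExt.induction with
  | hadd x y hx hy => rw [map_add, map_add, hx, hy]
  | htmul b v =>
    rw [coord, lift_tmul, map_smul, ← smul_one_tmul]
    congr 1
    conv_rhs => rw [← hs v]
    change Finsupp.linearCombination B _ (Finsupp.mapRange φ (map_zero φ) (s v)) = _
    rw [Finsupp.linearCombination_apply, Finsupp.linearCombination_apply,
      Finsupp.sum_mapRange_index (by simp)]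
    have : ∀ f : V →₀ S, tmul φ 1 (f.sum fun i a => a • id i) =
        f.sum fun i a => tmul φ 1 (a • i) := fun f =>
      map_finsuppSum (tmulHom φ 1) f _
    rw [this]
    exact Finsupp.sum_congr fun w _ => by rw [tmul_smul, smul_one_tmul, one_mul]

theorem coord_map {s : V →ₗ[S] V →₀ S} (π : B →+* B') (h : ∀ s, π (φ s) = ψ s)
    (x : BaseExt φ V) (w : V) : coord ψ s (map φ ψ V π h x) w = π (coord φ s x w) := by
  induction x using BaseExt.induction with
  | hadd x y hx hy => simp only [map_add, Finsupp.add_apply, hx, hy]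
  | htmul b v => rw [map_tmul, coord_tmul, coord_tmul, map_mul, h]

/-- The homogeneous component of degree `k` of an element of `B ⊗_S V`, when `B` has projections
`c i` onto its homogeneous components, which are linear over `S` on the right. -/
def comp (c : ℕ → B →+ B) (hc : ∀ i b s, c i (b * φ s) = c i b * φ s)
    {gr : ℕ → Submodule S V} (hgr : DirectSum.IsInternal gr) (k : ℕ) :
    BaseExt φ V →+ BaseExt φ V :=
  liftAdd φ (∑ ij ∈ Finset.HasAntidiagonal.antidiagonal k,
    ((tmulHom φ).comp (c ij.1)).compl₂ (gradedProj hgr ij.2).toAddMonoidHom)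
    (fun b s v => by simp [AddMonoidHom.finsetSum_apply, hc, tmulHom, tmul_smul])

theorem comp_tmul (c : ℕ → B →+ B) (hc : ∀ i b s, c i (b * φ s) = c i b * φ s)
    {gr : ℕ → Submodule S V} (hgr : DirectSum.IsInternal gr) (k : ℕ) (b : B) (v : V) :
    comp φ c hc hgr k (tmul φ b v) = ∑ ij ∈ Finset.HasAntidiagonal.antidiagonal k,
      tmul φ (c ij.1 b) (gradedProj hgr ij.2 v) := by
  rw [comp, liftAdd_tmul]
  simp [AddMonoidHom.finsetSum_apply, tmulHom]

variable {φ} in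
theorem tmul_mem_deg {𝓑 : ℕ → AddSubgroup B} {𝒱 : ℕ → Submodule S V} {b : B} {v : V} {i j n : ℕ}
    (hb : b ∈ 𝓑 i) (hv : v ∈ 𝒱 j) (h : i + j = n) : tmul φ b v ∈ deg φ 𝓑 𝒱 n :=
  AddSubgroup.subset_closure ⟨i, j, h, b, hb, v, hv, rfl⟩

theorem smul_mem_deg {𝓑 : ℕ → AddSubgroup B} {𝒱 : ℕ → Submodule S V}
    (hmul : ∀ {i j b c}, b ∈ 𝓑 i → c ∈ 𝓑 j → b * c ∈ 𝓑 (i + j)) {i j n : ℕ} {b : B}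
    {x : BaseExt φ V} (hb : b ∈ 𝓑 i) (hx : x ∈ deg φ 𝓑 𝒱 j) (h : i + j = n) :
    b • x ∈ deg φ 𝓑 𝒱 n := by
  subst h
  induction hx using AddSubgroup.closure_induction with
  | zero => simp
  | neg x _ hx => rw [smul_neg]; exact neg_mem hx
  | add x y _ _ hx hy => rw [smul_add]; exact add_mem hx hy
  | mem x hx =>
    obtain ⟨k, l, rfl, c, hc, v, hv, rfl⟩ := hx
    rw [smul_tmul]
    exact tmul_mem_deg (hmul hb hc) hv (add_assoc i k l)

end BaseExt

namespace SpecialResolution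

variable {S : Type*} {T : Type*} [Ring S] [Ring T] {𝒯 : ConnGradedRing S T}
  {P : SSubbimodule 𝒯} (R : SpecialResolution P)

/-! ### The graded `D`-modules `D ⊗ Vₙ` -/

theorem smul_mem_degN {n i j k : ℕ} {b : P.D} {x : R.N n} (hb : b ∈ P.degD i)
    (hx : x ∈ R.degN n j) (h : i + j = k) : b • x ∈ R.degN n k :=
  BaseExt.smul_mem_deg (𝓑 := P.degD) (𝒱 := R.gr n) P.unitD
    (fun hb hc => P.mul_mem_degD hb hc) hb hx h

theorem one_tmul_mem_degN {n i : ℕ} {v : R.V n} (hv : v ∈ R.gr n i) :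
    BaseExt.tmul P.unitD 1 v ∈ R.degN n i :=
  BaseExt.tmul_mem_deg P.one_mem_degD hv (zero_add i)

/-- The projection of `Nₙ` onto its homogeneous component of degree `k`. -/
def compN (n k : ℕ) : R.N n →+ R.N n :=
  BaseExt.comp P.unitD P.compD (fun i d s => P.compD_mul d (P.unitD_mem s) i) (R.internal n) k

theorem compN_tmul (n k : ℕ) (b : P.D) (v : R.V n) :
    R.compN n k (BaseExt.tmul P.unitD b v) = ∑ ij ∈ Finset.HasAntidiagonal.antidiagonal k,
      BaseExt.tmul P.unitD (P.compD ij.1 b) (gradedProj (R.internal n) ij.2 v) :=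
  BaseExt.comp_tmul _ _ _ _ _ _ _

theorem compN_mem (n k : ℕ) (x : R.N n) : R.compN n k x ∈ R.degN n k := by
  induction x using BaseExt.induction with
  | hadd x y hx hy => rw [map_add]; exact add_mem hx hy
  | htmul b v =>
    rw [compN_tmul]
    exact sum_mem fun ij hij => BaseExt.tmul_mem_deg (P.compD_mem _ _) (gradedProj_mem _ _ _)
      (Finset.HasAntidiagonal.mem_antidiagonal.1 hij)

theorem compN_of_mem {n k : ℕ} {x : R.N n} (hx : x ∈ R.degN n k) : R.compN n k x = x := by
  induction hx using AddSubgroup.closure_induction with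
  | zero => exact map_zero _
  | neg x _ hx => rw [map_neg, hx]
  | add x y _ _ hx hy => rw [map_add, hx, hy]
  | mem x hx =>
    obtain ⟨i, j, rfl, b, hb, v, hv, rfl⟩ := hx
    rw [compN_tmul, Finset.sum_eq_single (i, j)]
    · rw [P.compD_of_mem hb, if_pos rfl, gradedProj_of_mem _ hv, if_pos rfl]
    · rintro ⟨i', j'⟩ - hne
      rw [P.compD_of_mem hb, gradedProj_of_mem _ hv]
      by_cases h : i = i'
      · rw [if_neg (c := j = j') (fun h' => hne (by rw [h, h'])), BaseExt.tmul_zero]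
      · rw [if_neg h, BaseExt.zero_tmul]
    · intro h
      exact (h (by simp)).elim

theorem compN_z_smul_zero (n : ℕ) (x : R.N n) : R.compN n 0 (P.z • x) = 0 := by
  induction x using BaseExt.induction with
  | hadd x y hx hy => rw [smul_add, map_add, hx, hy, add_zero]
  | htmul b v =>
    rw [BaseExt.smul_tmul, compN_tmul, P.z_mul]
    simp [P.compD_mul_of_lt b P.z_mem_degD zero_lt_one]

theorem compN_z_smul_succ (n k : ℕ) (x : R.N n) :
    R.compN n (k + 1) (P.z • x) = P.z • R.compN n k x := by
  induction x using BaseExt.induction with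
  | hadd x y hx hy => rw [smul_add, map_add, hx, hy, map_add, smul_add]
  | htmul b v =>
    rw [BaseExt.smul_tmul, compN_tmul, compN_tmul, P.z_mul, Finset.Nat.antidiagonal_succ,
      Finset.sum_cons, P.compD_mul_of_lt b P.z_mem_degD zero_lt_one, BaseExt.zero_tmul, zero_add,
      Finset.sum_map, Finset.smul_sum]
    refine Finset.sum_congr rfl fun ij _ => ?_
    rw [BaseExt.smul_tmul, P.z_mul, ← P.compD_mul b P.z_mem_degD]
    rfl

/-! ### The reduction `π ⊗ Vₙ : D ⊗ Vₙ → A ⊗ Vₙ` -/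

theorem piV_tmul (n : ℕ) (b : P.D) (v : R.V n) :
    R.piV n (BaseExt.tmul P.unitD b v) = BaseExt.tmul P.unitA (P.piDA b) v := rfl

theorem piV_surjective (n : ℕ) : Function.Surjective (R.piV n) := fun y => by
  induction y using BaseExt.induction with
  | hadd x y hx hy =>
    obtain ⟨x, rfl⟩ := hx
    obtain ⟨y, rfl⟩ := hy
    exact ⟨x + y, map_add _ _ _⟩
  | htmul a v =>
    obtain ⟨t, rfl⟩ : ∃ t, P.mkA t = a := Ideal.Quotient.mk_surjective a
    refine ⟨BaseExt.tmul P.unitD (P.mkD (C t)) v, ?_⟩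
    rw [piV_tmul, P.piDA_mkD, constantCoeff_apply, coeff_C_zero]

theorem exists_mem_degN_piV_eq {n k : ℕ} {y : BaseExt P.unitA (R.V n)}
    (hy : y ∈ BaseExt.deg P.unitA (fun i => (P.degA i).toAddSubgroup) (R.gr n) k) :
    ∃ x ∈ R.degN n k, R.piV n x = y := by
  induction hy using AddSubgroup.closure_induction with
  | zero => exact ⟨0, zero_mem _, map_zero _⟩
  | neg x _ hx =>
    obtain ⟨x, hx, rfl⟩ := hx
    exact ⟨-x, neg_mem hx, map_neg _ _⟩
  | add x y _ _ hx hy =>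
    obtain ⟨x, hx, rfl⟩ := hx
    obtain ⟨y, hy, rfl⟩ := hy
    exact ⟨x + y, add_mem hx hy, map_add _ _ _⟩
  | mem x hx =>
    obtain ⟨i, j, rfl, a, ha, v, hv, rfl⟩ := hx
    obtain ⟨d, hd, rfl⟩ := P.exists_mem_degD_of_mem_degA ha
    exact ⟨_, BaseExt.tmul_mem_deg hd hv rfl, R.piV_tmul n d v⟩

theorem piV_z_smul (n : ℕ) (x : R.N n) : R.piV n (P.z • x) = 0 := by
  rw [map_smulₛₗ, P.piDA_z, zero_smul]

/-- `ker (π ⊗ Vₙ) = z Nₙ`. Since `Vₙ` is projective, this can be read off from coordinates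
in `D`, where it says `ker π = z D`. -/
theorem exists_z_smul_of_piV_eq_zero {n : ℕ} {x : R.N n} (hx : R.piV n x = 0) :
    ∃ y, P.z • y = x := by
  obtain ⟨s, hs⟩ := (R.projective n).out
  have h : ∀ w, ∃ e, BaseExt.coord P.unitD s x w = P.z * e := fun w => by
    refine P.exists_z_mul_of_piDA_eq_zero ?_
    have := BaseExt.coord_map P.unitD P.unitA (s := s) P.piDA P.piDA_unitD x w
    rw [← this]
    change BaseExt.coord P.unitA s (R.piV n x) w = 0
    rw [hx, map_zero, Finsupp.zero_apply]
  choose e he using h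
  rw [← BaseExt.linearCombination_coord P.unitD hs x]
  refine ⟨(BaseExt.coord P.unitD s x).sum fun w _ => e w • BaseExt.tmul P.unitD 1 w, ?_⟩
  rw [Finsupp.linearCombination_apply, Finsupp.smul_sum]
  exact Finsupp.sum_congr fun w _ => by rw [he, mul_smul]

theorem eq_zero_of_piV_eq_zero {n : ℕ} {x : R.N n} (hx : x ∈ R.degN n 0) (h : R.piV n x = 0) :
    x = 0 := by
  obtain ⟨y, rfl⟩ := R.exists_z_smul_of_piV_eq_zero h
  rw [← R.compN_of_mem hx, compN_z_smul_zero]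

/-- The homogeneous form of `ker (π ⊗ Vₙ) = z Nₙ`. -/
theorem exists_mem_degN_of_piV_eq_zero {n k : ℕ} {x : R.N n} (hx : x ∈ R.degN n (k + 1))
    (h : R.piV n x = 0) : ∃ y ∈ R.degN n k, P.z • y = x := by
  obtain ⟨y, rfl⟩ := R.exists_z_smul_of_piV_eq_zero h
  exact ⟨R.compN n k y, R.compN_mem n k y, by rw [← compN_z_smul_succ, R.compN_of_mem hx]⟩

/-! ### Existence of the lifts `∂ₙ` and `fₙ` -/

/-- Construction of graded `D`-linear maps `D ⊗ Vₘ → Nₙ` from the lifting property of the graded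
projective module `Vₘ`, with respect to an `S`-linear map `q` out of `Nₙ`. -/
theorem exists_linear_lift {m n : ℕ} {B' N' : Type*} [Ring B'] [AddCommGroup N'] [Module B' N']
    (ψ : S →+* B') (q : R.N n →+ N') (hq : ∀ s x, q (P.unitD s • x) = ψ s • q x)
    (h : R.V m →+ N') (hh : ∀ s v, h (s • v) = ψ s • h v)
    (Q : ℕ → AddSubgroup (R.N n)) (hQ : ∀ i s, ∀ x ∈ Q i, P.unitD s • x ∈ Q i)
    (H : ∀ i, ∀ v ∈ R.gr m i, ∃ x ∈ Q i, q x = h v) :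
    ∃ F : R.N m →ₗ[P.D] R.N n,
      ∀ i, ∀ v ∈ R.gr m i, F (BaseExt.tmul P.unitD 1 v) ∈ Q i ∧
        q (F (BaseExt.tmul P.unitD 1 v)) = h v := by
  let _ : Module S (R.N n) := Module.compHom _ P.unitD
  let _ : Module S N' := Module.compHom _ ψ
  have := R.projective m
  obtain ⟨F, hF⟩ := exists_graded_lift (R.internal m)
    ({ q with map_smul' := hq } : R.N n →ₗ[S] N') ({ h with map_smul' := hh } : R.V m →ₗ[S] N')
    (fun i => { Q i with smul_mem' := fun s x hx => hQ i s x hx }) H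
  have hlin : ∀ s v, F.toAddMonoidHom (s • v) = P.unitD s • F.toAddMonoidHom v := map_smul F
  refine ⟨BaseExt.lift P.unitD F.toAddMonoidHom hlin, fun i v hv => ?_⟩
  have h1 : BaseExt.lift P.unitD F.toAddMonoidHom hlin (BaseExt.tmul P.unitD 1 v) = F v :=
    (BaseExt.lift_tmul P.unitD _ hlin 1 v).trans (one_smul _ _)
  rw [h1]
  exact hF i v hv

/-- `D ⊗ Vₙ` is generated over `D` by the elements `1 ⊗ v` with `v` homogeneous. -/
theorem ext_one_tmul {n : ℕ} {M : Type*} [AddCommGroup M] {F G : R.N n →+ M}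
    (h : ∀ (b : P.D) i, ∀ v ∈ R.gr n i,
      F (b • BaseExt.tmul P.unitD 1 v) = G (b • BaseExt.tmul P.unitD 1 v)) : F = G := by
  ext x
  induction x using BaseExt.induction with
  | hadd x y hx hy => rw [map_add, map_add, hx, hy]
  | htmul b v =>
    induction v using graded_induction (R.internal n) with
    | hmem i v hv => simpa [BaseExt.smul_one_tmul] using h b i v hv
    | hadd v w hv hw => rw [BaseExt.tmul_add, map_add, map_add, hv, hw]

theorem exists_del (n : ℕ) : ∃ del : R.N (n + 1) →ₗ[P.D] R.N n,
    (∀ k, ∀ x ∈ R.degN (n + 1) k, del x ∈ R.degN n k) ∧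
      ∀ x, R.piV n (del x) = R.d n (R.piV (n + 1) x) := by
  obtain ⟨F, hF⟩ := R.exists_linear_lift (m := n + 1) (n := n) P.unitA (R.piV n).toAddMonoidHom
    (fun s x => by
      change R.piV n _ = P.unitA s • R.piV n x
      rw [map_smulₛₗ, P.piDA_unitD])
    ((R.d n).toAddMonoidHom.comp (BaseExt.tmulHom P.unitA 1))
    (fun s v => by
      change R.d n (BaseExt.tmul P.unitA 1 (s • v)) = P.unitA s • R.d n (BaseExt.tmul P.unitA 1 v)
      rw [BaseExt.tmul_smul, one_mul, ← map_smul, BaseExt.smul_one_tmul])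
    (R.degN n) (fun i s x hx => R.smul_mem_degN (P.unitD_mem s) hx (zero_add i))
    (fun i v hv => R.exists_mem_degN_piV_eq (R.d_graded n i _
      (BaseExt.tmul_mem_deg ⟨1, 𝒯.one_mem_deg, map_one P.mkA⟩ hv (zero_add i))))
  refine ⟨F, fun k x hx => ?_, fun x => ?_⟩
  · induction hx using AddSubgroup.closure_induction with
    | zero => simp
    | neg x _ hx => rw [map_neg]; exact neg_mem hx
    | add x y _ _ hx hy => rw [map_add]; exact add_mem hx hy
    | mem x hx =>
      obtain ⟨i, j, rfl, b, hb, v, hv, rfl⟩ := hx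
      rw [← BaseExt.smul_one_tmul, map_smul]
      exact R.smul_mem_degN hb (hF j v hv).1 rfl
  · refine DFunLike.congr_fun (R.ext_one_tmul (F := (R.piV n).toAddMonoidHom.comp F.toAddMonoidHom)
      (G := (R.d n).toAddMonoidHom.comp (R.piV (n + 1)).toAddMonoidHom) fun b i v hv => ?_) x
    change R.piV n (F (b • BaseExt.tmul P.unitD 1 v)) =
      R.d n (R.piV (n + 1) (b • BaseExt.tmul P.unitD 1 v))
    rw [map_smul, map_smulₛₗ, map_smulₛₗ, map_smul, piV_tmul, map_one]
    exact congrArg _ (hF i v hv).2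

/-- Since `dₙ₊₁ dₙ₊₂ = 0`, the composition `∂ₙ₊₁ ∂ₙ₊₂` is divisible by `z`. -/
theorem exists_f {n : ℕ} (del : R.N (n + 2) →ₗ[P.D] R.N (n + 1))
    (del' : R.N (n + 1) →ₗ[P.D] R.N n)
    (hdel : ∀ k, ∀ x ∈ R.degN (n + 2) k, del x ∈ R.degN (n + 1) k)
    (hdel' : ∀ k, ∀ x ∈ R.degN (n + 1) k, del' x ∈ R.degN n k)
    (hpi : ∀ x, R.piV (n + 1) (del x) = R.d (n + 1) (R.piV (n + 2) x))
    (hpi' : ∀ x, R.piV n (del' x) = R.d n (R.piV (n + 1) x)) :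
    ∃ f : R.N (n + 2) →ₗ[P.D] R.N n,
      (∀ k, ∀ x ∈ R.degN (n + 2) (k + 1), f x ∈ R.degN n k) ∧
      (∀ x ∈ R.degN (n + 2) 0, f x = 0) ∧
      ∀ x, del' (del x) = (-1 : ℤ) ^ (n + 1) • (P.z • f x) := by
  -- `∂∂` reduces to `dd = 0` modulo `z`, so that it takes values in `z Nₙ`.
  have hzero : ∀ x, R.piV n (del' (del x)) = 0 := fun x => by
    rw [hpi', hpi]
    exact (R.exact n).apply_apply_eq_zero _
  have hsq : ((-1 : ℤ) ^ (n + 1)) * (-1) ^ (n + 1) = 1 := by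
    rw [← mul_pow]; simp
  obtain ⟨F, hF⟩ := R.exists_linear_lift (m := n + 2) (n := n) P.unitD
    (P.zAct (R.N n)).toAddMonoidHom
    (fun s x => map_smul (P.zAct (R.N n)) (P.unitD s) x)
    (((-1 : ℤ) ^ (n + 1) • (del' ∘ₗ del)).toAddMonoidHom.comp (BaseExt.tmulHom P.unitD 1))
    (fun s v => by
      change ((-1 : ℤ) ^ (n + 1) • (del' ∘ₗ del)) (BaseExt.tmul P.unitD 1 (s • v)) =
        P.unitD s • ((-1 : ℤ) ^ (n + 1) • (del' ∘ₗ del)) (BaseExt.tmul P.unitD 1 v)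
      rw [BaseExt.tmul_smul, one_mul, ← map_smul, BaseExt.smul_one_tmul])
    -- The component of degree `i` of the shift `Nₙ(-1)`; it vanishes for `i = 0`.
    (fun i => Nat.casesOn i ⊥ (R.degN n))
    (fun i s x hx => by
      cases i with
      | zero => rw [(AddSubgroup.mem_bot).1 hx, smul_zero]; exact zero_mem _
      | succ i => exact R.smul_mem_degN (P.unitD_mem s) hx (zero_add i))
    (fun i v hv => by
      have hmem := zsmul_mem (hdel' i _ (hdel i _ (R.one_tmul_mem_degN hv))) ((-1 : ℤ) ^ (n + 1))
      have hpi0 : R.piV n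
          ((-1 : ℤ) ^ (n + 1) • del' (del (BaseExt.tmul P.unitD 1 v))) = 0 := by
        rw [map_zsmul, hzero, smul_zero]
      cases i with
      | zero => exact ⟨0, zero_mem _, (map_zero _).trans (R.eq_zero_of_piV_eq_zero hmem hpi0).symm⟩
      | succ i => exact R.exists_mem_degN_of_piV_eq_zero hmem hpi0)
  have hgen : ∀ k, ∀ x ∈ R.degN (n + 2) k, F x ∈ (Nat.casesOn k ⊥ (R.degN n) :
      AddSubgroup (R.N n)) := fun k x hx => by
    induction hx using AddSubgroup.closure_induction with
    | zero => rw [map_zero]; exact zero_mem _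
    | neg x _ hx => rw [map_neg]; exact neg_mem hx
    | add x y _ _ hx hy => rw [map_add]; exact add_mem hx hy
    | mem x hx =>
      obtain ⟨i, j, rfl, b, hb, v, hv, rfl⟩ := hx
      rw [← BaseExt.smul_one_tmul, map_smul]
      have h1 := (hF j v hv).1
      cases j with
      | zero =>
        rw [(AddSubgroup.mem_bot).1 h1, smul_zero]
        exact zero_mem _
      | succ j => exact R.smul_mem_degN hb h1 rfl
  refine ⟨F, fun k => hgen (k + 1), fun x hx => (AddSubgroup.mem_bot).1 (hgen 0 x hx), fun x => ?_⟩
  refine DFunLike.congr_fun (R.ext_one_tmul (F := (del' ∘ₗ del).toAddMonoidHom)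
    (G := ((-1 : ℤ) ^ (n + 1) • (P.zAct (R.N n) ∘ₗ F)).toAddMonoidHom) fun b i v hv => ?_) x
  change (del' ∘ₗ del) (b • BaseExt.tmul P.unitD 1 v) =
    ((-1 : ℤ) ^ (n + 1) • (P.zAct (R.N n) ∘ₗ F)) (b • BaseExt.tmul P.unitD 1 v)
  rw [map_smul, map_smul]
  congr 1
  have h1 : P.z • F (BaseExt.tmul P.unitD 1 v) =
      (-1 : ℤ) ^ (n + 1) • del' (del (BaseExt.tmul P.unitD 1 v)) := (hF i v hv).2
  change del' (del (BaseExt.tmul P.unitD 1 v)) =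
    (-1 : ℤ) ^ (n + 1) • (P.z • F (BaseExt.tmul P.unitD 1 v))
  rw [h1, smul_smul, hsq, one_smul]

theorem nonempty_lift : Nonempty R.Lift := by
  choose del h1 h2 using R.exists_del
  choose f h3 h4 h5 using fun n =>
    R.exists_f (del (n + 1)) (del n) (h1 (n + 1)) (h1 n) (h2 (n + 1)) (h2 n)
  exact ⟨⟨del, h1, h2, f, h3, h4, h5⟩⟩

end SpecialResolution

namespace SpecialResolution

variable {S : Type*} {T : Type*} [Ring S] [Ring T] {𝒯 : ConnGradedRing S T}
  {P : SSubbimodule 𝒯} (R : SpecialResolution P)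

/-! ### The identification of `N₀` with `D` -/

/-- The identification `N₀ = D ⊗ V₀ → D`, `d ⊗ v ↦ d v`, coming from `V₀ = S`. -/
def evalN0 : R.N 0 →ₗ[P.D] P.D :=
  BaseExt.lift P.unitD ((P.unitD : S →+ P.D).comp R.e0.symm.toLinearMap.toAddMonoidHom)
    fun s v => by simp

theorem evalN0_tmul (b : P.D) (v : R.V 0) :
    R.evalN0 (BaseExt.tmul P.unitD b v) = b * P.unitD (R.e0.symm v) :=
  BaseExt.lift_tmul _ _ _ _ _

theorem tmul_evalN0 (x : R.N 0) : BaseExt.tmul P.unitD (R.evalN0 x) (R.e0 1) = x := by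
  induction x using BaseExt.induction with
  | hadd x y hx hy => rw [map_add, BaseExt.add_tmul, hx, hy]
  | htmul b v =>
    rw [evalN0_tmul, ← BaseExt.tmul_smul, ← map_smul, smul_eq_mul, mul_one,
      LinearEquiv.apply_symm_apply]

theorem evalN0_tmul_one (b : P.D) : R.evalN0 (BaseExt.tmul P.unitD b (R.e0 1)) = b := by
  rw [evalN0_tmul, LinearEquiv.symm_apply_apply, map_one, mul_one]

theorem evalN0_eq_zero {x : R.N 0} (h : R.evalN0 x = 0) : x = 0 := by
  rw [← R.tmul_evalN0 x, h, BaseExt.zero_tmul]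

theorem evalN0_mem {x : R.N 0} {k : ℕ} (hx : x ∈ R.degN 0 k) : R.evalN0 x ∈ P.degD k := by
  induction hx using AddSubgroup.closure_induction with
  | zero => rw [map_zero]; exact zero_mem _
  | neg x _ hx => rw [map_neg]; exact neg_mem hx
  | add x y _ _ hx hy => rw [map_add]; exact add_mem hx hy
  | mem x hx =>
    obtain ⟨i, j, rfl, b, hb, v, hv, rfl⟩ := hx
    have h0 : v ∈ R.gr 0 0 := R.gr_zero ▸ Submodule.mem_top
    have hj := gradedProj_of_mem (R.internal 0) hv j
    rw [gradedProj_of_mem (R.internal 0) h0, if_pos rfl] at hj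
    rw [evalN0_tmul]
    split_ifs at hj with h
    · subst h
      exact P.mul_mem_degD hb (P.unitD_mem _)
    · rw [← hj, map_zero, map_zero, mul_zero]
      exact zero_mem _

theorem subsingleton_H1_iff (L : R.Lift) :
    Subsingleton L.H1 ↔ ∀ x y, L.delta1 (x, y) = 0 → ∃ w u, L.delta 0 (w, u) = (x, y) := by
  rw [Submodule.Quotient.subsingleton_iff, LinearMap.range_eq_top]
  constructor
  · intro h x y hxy
    obtain ⟨⟨w, u⟩, hwu⟩ := h ⟨(x, y), hxy⟩
    exact ⟨w, u, congrArg Subtype.val hwu⟩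
  · rintro h ⟨⟨x, y⟩, hxy⟩
    obtain ⟨w, u, hwu⟩ := h x y hxy
    exact ⟨(w, u), Subtype.ext hwu⟩

namespace Lift

variable {R} (L : R.Lift)

theorem delta1_apply (x : R.N 1) (y : R.N 0) : L.delta1 (x, y) = L.del 0 x + P.z • y := rfl

theorem delta_zero_apply (w : R.N 2) (u : R.N 1) :
    L.delta 0 (w, u) = (L.del 1 w - P.z • u, L.f 0 w + L.del 0 u) := by
  change (L.del 1 w + (-1 : ℤ) ^ (0 + 1) • (P.z • u), L.f 0 w + L.del 0 u) = _
  simp [sub_eq_add_neg]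

theorem del_del_zero (w : R.N 2) : L.del 0 (L.del 1 w) = -(P.z • L.f 0 w) := by
  simpa using L.del_del 0 w

theorem del_del_one (v : R.N 3) : L.del 1 (L.del 2 v) = P.z • L.f 1 v := by
  simpa using L.del_del 1 v

/-! ### The homology `H₁` and the regularity of `z` -/

/-- If `z` is regular on `D`, the exactness of `A ⊗ V₂ → A ⊗ V₁ → A` lifts to `H₁ = 0`. -/
theorem subsingleton_H1_of_z_regular (hz : ∀ d : P.D, P.z * d = 0 → d = 0) :
    Subsingleton L.H1 := by
  rw [subsingleton_H1_iff]
  intro x y hxy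
  rw [delta1_apply] at hxy
  have h1 : R.d 0 (R.piV 1 x) = 0 := by
    rw [← L.piV_del, eq_neg_of_add_eq_zero_left hxy, map_neg, R.piV_z_smul, neg_zero]
  obtain ⟨a, ha⟩ := (R.exact 0 _).1 h1
  obtain ⟨w, rfl⟩ := R.piV_surjective 2 a
  have h2 : R.piV 1 (L.del 1 w - x) = 0 := by
    rw [map_sub, L.piV_del, ha, sub_self]
  obtain ⟨u, hu⟩ := R.exists_z_smul_of_piV_eq_zero h2
  refine ⟨w, u, ?_⟩
  rw [delta_zero_apply, hu, sub_sub_cancel]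
  -- The second component is determined, since `z` is regular on `N₀ = D`.
  have h3 : P.z • (L.f 0 w + L.del 0 u - y) = 0 := by
    have h4 : P.z • L.del 0 u = -(P.z • L.f 0 w) - L.del 0 x := by
      rw [← map_smul, hu, map_sub, L.del_del_zero]
    rw [smul_sub, smul_add, h4, eq_neg_of_add_eq_zero_left hxy]
    abel
  have h5 : L.f 0 w + L.del 0 u - y = 0 := R.evalN0_eq_zero (hz _ (by
    rw [← smul_eq_mul, ← map_smul, h3, map_zero]))
  rw [sub_eq_zero.1 h5]

/-- The Jacobi conditions up to the complexity of `V₃` make `M₃ → M₂ → M₁` a complex: the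
obstruction `∂₁ f₃ + f₂ ∂₃` is annihilated by `z` and maps the generators `V₃ⁱ` to
`N₀^{i - 1} = D^{i - 1}`. -/
theorem del_f_add_f_del_eq_zero
    (hJ : ∀ i, R.gr 3 i ≠ ⊥ → 1 ≤ i ∧ P.Jacobi (i - 1)) (v : R.N 3) :
    L.del 0 (L.f 1 v) + L.f 0 (L.del 2 v) = 0 := by
  refine DFunLike.congr_fun (R.ext_one_tmul
    (F := (L.del 0 ∘ₗ L.f 1 + L.f 0 ∘ₗ L.del 2).toAddMonoidHom) (G := 0) fun b i v hv => ?_) v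
  change (L.del 0 ∘ₗ L.f 1 + L.f 0 ∘ₗ L.del 2) (b • BaseExt.tmul P.unitD 1 v) = 0
  rw [map_smul]
  by_cases hi : R.gr 3 i = ⊥
  · rw [hi, Submodule.mem_bot] at hv
    rw [hv, BaseExt.tmul_zero, map_zero, smul_zero]
  · obtain ⟨h1, hJi⟩ := hJ i hi
    obtain ⟨i, rfl⟩ := Nat.exists_eq_add_of_le' h1
    have hmem := R.one_tmul_mem_degN hv
    set x : R.N 3 := BaseExt.tmul P.unitD 1 v
    have hdeg : L.del 0 (L.f 1 x) + L.f 0 (L.del 2 x) ∈ R.degN 0 i :=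
      add_mem (L.del_graded 0 i _ (L.f_graded 1 i x hmem))
        (L.f_graded 0 i _ (L.del_graded 2 _ x hmem))
    have hz : P.z • (L.del 0 (L.f 1 x) + L.f 0 (L.del 2 x)) = 0 := by
      rw [smul_add, ← map_smul, ← L.del_del_one, L.del_del_zero, neg_add_cancel]
    have h0 : L.del 0 (L.f 1 x) + L.f 0 (L.del 2 x) = 0 :=
      R.evalN0_eq_zero (hJi.eq_zero_of_z_mul (R.evalN0_mem hdeg) (by
        rw [← smul_eq_mul, ← map_smul, hz, map_zero]))
    change b • (L.del 0 (L.f 1 x) + L.f 0 (L.del 2 x)) = 0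
    rw [h0, smul_zero]

/-- If `H₁ = 0` and `M₃ → M₂ → M₁` is a complex, then every `y ∈ D` with `z y = 0` is of the form
`∂₁ u` with `z u = 0`. -/
theorem exists_del_eq_of_z_mul (hH : Subsingleton L.H1)
    (hcomplex : ∀ v, L.del 0 (L.f 1 v) + L.f 0 (L.del 2 v) = 0) {y : R.N 0} (hy : P.z • y = 0) :
    ∃ u : R.N 1, P.z • u = 0 ∧ L.del 0 u = y := by
  rw [subsingleton_H1_iff] at hH
  obtain ⟨w, u, h⟩ := hH 0 y (by rw [delta1_apply, map_zero, hy, add_zero])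
  rw [delta_zero_apply, Prod.mk.injEq, sub_eq_zero] at h
  obtain ⟨h1, h2⟩ := h
  have h3 : R.d 1 (R.piV 2 w) = 0 := by
    rw [← L.piV_del, h1, R.piV_z_smul]
  obtain ⟨a, ha⟩ := (R.exact 1 _).1 h3
  obtain ⟨v, rfl⟩ := R.piV_surjective 3 a
  have h4 : R.piV 2 (w - L.del 2 v) = 0 := by
    rw [map_sub, L.piV_del, ha, sub_self]
  obtain ⟨t, ht⟩ := R.exists_z_smul_of_piV_eq_zero h4
  -- Modify `(w, u)` by the boundary `δ₃ (v, t)`, which makes the first component vanish.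
  have hw : w = L.del 2 v + P.z • t := by rw [ht]; abel
  refine ⟨u - L.del 1 t - L.f 1 v, ?_, ?_⟩
  · rw [smul_sub, smul_sub, ← h1, hw, map_add, map_smul, L.del_del_one]
    abel
  · have h5 : L.f 0 (L.del 2 v) = -L.del 0 (L.f 1 v) :=
      eq_neg_of_add_eq_zero_right (hcomplex v)
    rw [map_sub, map_sub, L.del_del_zero, ← h2, hw, map_add, map_smul, h5]
    abel

/-- Under the same hypotheses, the annihilator `K` of `z` in `D` satisfies `K = K D¹`. The
projectivity of `V₁` gives `ker (z on N₁) = K ⊗ V₁`, and `∂₁` maps `V₁` to `D¹`. -/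
theorem mem_closure_of_z_mul (hH : Subsingleton L.H1)
    (hcomplex : ∀ v, L.del 0 (L.f 1 v) + L.f 0 (L.del 2 v) = 0) {y : P.D} (hy : P.z * y = 0) :
    y ∈ AddSubgroup.closure {x | ∃ k e, P.z * k = 0 ∧ e ∈ P.degD 1 ∧ x = k * e} := by
  obtain ⟨u, hu, huy⟩ := L.exists_del_eq_of_z_mul hH hcomplex
    (y := BaseExt.tmul P.unitD y (R.e0 1)) (by rw [BaseExt.smul_tmul, hy, BaseExt.zero_tmul])
  obtain ⟨s, hs⟩ := (R.projective 1).out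
  have hc : ∀ v, P.z * BaseExt.coord P.unitD s u v = 0 := fun v => by
    rw [← smul_eq_mul, ← Finsupp.smul_apply, ← map_smul, hu, map_zero, Finsupp.zero_apply]
  rw [← R.evalN0_tmul_one y, ← huy, ← BaseExt.linearCombination_coord P.unitD hs u,
    Finsupp.linearCombination_apply, map_finsuppSum, map_finsuppSum]
  refine sum_mem fun v _ => AddSubgroup.subset_closure
    ⟨BaseExt.coord P.unitD s u v, R.evalN0 (L.del 0 (BaseExt.tmul P.unitD 1 v)), hc v, ?_, ?_⟩
  · exact R.evalN0_mem (L.del_graded 0 1 _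
      (R.one_tmul_mem_degN (R.gr_one ▸ Submodule.mem_top)))
  · dsimp only
    rw [map_smul, map_smul, smul_eq_mul]

/-- The annihilator `K` of `z` satisfies `K = K D¹`, hence `K = K (D¹)ᵐ ⊆ D^{≥ m}` for all `m`, so
that `K = 0`. -/
theorem z_regular (hH : Subsingleton L.H1)
    (hcomplex : ∀ v, L.del 0 (L.f 1 v) + L.f 0 (L.del 2 v) = 0) (y : P.D) (hy : P.z * y = 0) :
    y = 0 := by
  refine P.eq_zero_of_compD_eq_zero fun n => ?_
  have key : ∀ n, (∀ k, P.z * k = 0 → ∀ e ∈ P.degD 1, P.compD n (k * e) = 0) →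
      ∀ y, P.z * y = 0 → P.compD n y = 0 := fun n hn y hy => by
    have hle : AddSubgroup.closure {x | ∃ k e, P.z * k = 0 ∧ e ∈ P.degD 1 ∧ x = k * e} ≤
        (P.compD n).ker := by
      rw [AddSubgroup.closure_le]
      rintro _ ⟨k, e, hk, he, rfl⟩
      exact hn k hk e he
    exact hle (L.mem_closure_of_z_mul hH hcomplex hy)
  induction n generalizing y with
  | zero => exact key 0 (fun k _ e he => P.compD_mul_of_lt k he zero_lt_one) y hy
  | succ n ih =>
    exact key (n + 1) (fun k hk e he => by rw [P.compD_mul k he, ih k hk, zero_mul]) y hy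

end Lift

/-- The Jacobi condition in the theorem, read degree by degree: the degrees `i` with `V₃ⁱ ≠ 0`
satisfy `i ≥ 2` by the vanishing assumption, and `i - 1 ≤ c_{V₃}`. -/
theorem jacobi_of_le_complexity
    (h : complexity (R.gr 3) = -1 ∨
      ∀ n : ℕ, 1 ≤ n → (n : EReal) ≤ complexity (R.gr 3) → P.Jacobi n)
    (i : ℕ) (hi : R.gr 3 i ≠ ⊥) : 1 ≤ i ∧ P.Jacobi (i - 1) := by
  have h2 : 2 ≤ i := by
    by_contra hlt
    exact hi (R.vanishing 3 le_rfl i (by omega))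
  obtain ⟨n, rfl⟩ := Nat.exists_eq_add_of_le' h2
  have hle : ((n + 1 : ℕ) : EReal) ≤ complexity (R.gr 3) := by
    rw [complexity, if_neg (fun h0 => hi (h0 _))]
    refine le_sSup ⟨n + 2, hi, ?_⟩
    have h3 : (((n + 1 : ℕ) : ℝ) : EReal) = (((n + 2 : ℕ) : ℝ) : EReal) - ((1 : ℝ) : EReal) := by
      rw [← EReal.coe_sub]
      congr 1
      push_cast
      ring
    exact h3
  refine ⟨by omega, ?_⟩
  rcases h with h | h
  · rw [h] at hle
    have h3 : (((n + 1 : ℕ) : ℝ) : EReal) ≤ ((-1 : ℝ) : EReal) := hle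
    rw [EReal.coe_le_coe_iff] at h3
    have : (0 : ℝ) ≤ ((n + 1 : ℕ) : ℝ) := Nat.cast_nonneg _
    linarith
  · exact h (n + 1) (by omega) hle

end SpecialResolution

end

theorem mainTheorem2 {S : Type*} {T : Type*} [Ring S] [Ring T] (𝒯 : ConnGradedRing S T)
    (hT : 𝒯.StronglyGraded) (P : SSubbimodule 𝒯) (hP : P.toAddSubgroup ⊓ 𝒯.deg 0 = ⊥)
    (hA : Module.Projective S (P.degA 1)) (R : SpecialResolution P) :
    Nonempty R.Lift ∧
    ∀ L : R.Lift,
      (P.PBWType ↔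
        (Subsingleton L.H1 ∧
          (complexity (R.gr 3) = -1 ∨
            ∀ n : ℕ, 1 ≤ n → (n : EReal) ≤ complexity (R.gr 3) → P.Jacobi n))) := by
  refine ⟨R.nonempty_lift, fun L => ⟨fun h => ⟨?_, Or.inr fun n _ _ => ?_⟩, fun ⟨h1, h2⟩ => ?_⟩⟩
  · exact L.subsingleton_H1_of_z_regular (P.pbwType_iff_z_regular.1 h)
  · exact P.pbwType_iff_forall_jacobi.1 h n
  · exact P.pbwType_iff_z_regular.2
      (L.z_regular h1 (L.del_f_add_f_del_eq_zero (R.jacobi_of_le_complexity h2)))
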